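/- Let $m$ be a mass function on $\Omega=\{1,\dots,n\}$, i.e. $m:2^\Omega\to[0,1]$, $m(\emptyset)=0$, $\sum_A m(A)=1$, and let $\mathcal F=\{A: m(A)>0\}$, $\mathrm{Bel}(B)=\sum_{A\subseteq B}m(A)$, $\mathrm{Pl}(B)=\sum_{A\cap B\neq\emptyset}m(A)$. The upper entropy of $\mathrm{Bel}$ is the maximum of $-\sum_i p_i\log p_i$ over all probability vectors $p$ with $\sum_{i\in A}p_i\ge \mathrm{Bel}(A)$ for all $A\subseteq\Omega$. For $\alpha\ge 0$ let $G_\alpha$ be the flow network with source $s$, sink $t$, a left vertex for every element $j\in\Omega$ and a right vertex for every $F\in\mathcal F$, and with the capacities $c(s,j)=\alpha$, $c(j,F)=+\infty$ if $j\in F$, $c(F,t)=m(F)$, and no other edges. The decomposition algorithm $\mathrm{DA}(S,S')$, started at $(\emptyset,\Omega)$, computes $\alpha=(\mathrm{Pl}(S')-\mathrm{Pl}(S))/|S'\setminus S|$ and the largest minimizer $S''$ of $A\mapsto \mathrm{Pl}(A)-\alpha|A|$ over $A\subseteq\Omega$; if $S''=S'$ it returns $\{S,S'\}$, and otherwise $\mathrm{DA}(S,S'')\cup\mathrm{DA}(S'',S')$.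 From the resulting chain $\emptyset=S_0\subset\dots\subset S_l=\Omega$ one sets $p_i=(\mathrm{Pl}(S_j)-\mathrm{Pl}(S_{j-1}))/|S_j\setminus S_{j-1}|$ for $i\in S_j\setminus S_{j-1}$, and returns $p$ and its entropy. Then: 1. For every $\alpha\ge0$ the network $G_\alpha$ has a maximum flow, and for every maximum flow the set $A^*$ of the left vertices that cannot reach $t$ in the residual graph minimizes $\mathrm{Pl}(A)-\alpha|A|$ and contains every other minimizer (so it is the unique minimizer of largest cardinality); the flow value is $\mathrm{Pl}(A^*)-\alpha|A^*|+n\alpha$. So each minimization step of the algorithm can be done by one maximum-flow computation and one depth-first search. 2. With the minimization steps done in this way, by any maximum-flow procedure, the algorithm terminates, $p$ attains the upper entropy of $\mathrm{Bel}$, and at most $Cn$ maximum-flow computations and at most $Cn$ depth-first searches are made, where $C$ is an absolute constant. If each maximum-flow computation takes at most $T$ steps, then the total number of steps is at most $Cn\,(T+(n+|\mathcal F|)^2)$, where a step is a bounded number of elementary operations (arithmetic operations, logarithms and comparisons of real numbers, membership tests, table accesses). 3. Consequently the running time is polynomial in $n$ and $|\mathcal F|$ for a suitable maximum-flow procedure: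 with the Edmonds-Karp algorithm the whole computation takes at most $C'(n+|\mathcal F|)^d$ steps, for absolute constants $C'$ and $d$. -/

import Mathlib

open scoped NNReal ENNReal

noncomputable section

namespace UpperEntropy

/-! ### Mass functions, belief functions, credal sets, entropy -/

/-- A mass function on `Ω = Fin n` (its values are at most `1`, being nonnegative with sum `1`). -/
structure MassFunction (n : ℕ) where
  mass : Finset (Fin n) → ℝ
  mass_nonneg : ∀ A, 0 ≤ mass A
  mass_empty : mass ∅ = 0
  mass_sum : ∑ A, mass A = 1

/-- The set `ℱ` of focal sets. -/
def MassFunction.focal {n : ℕ} (m : MassFunction n) : Finset (Finset (Fin n)) :=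
  Finset.univ.filter fun A => 0 < m.mass A

/-- The belief function `Bel(B) = ∑_{A ⊆ B} m(A)`. -/
def MassFunction.bel {n : ℕ} (m : MassFunction n) (B : Finset (Fin n)) : ℝ :=
  ∑ A ∈ Finset.univ.filter (fun A => A ⊆ B), m.mass A

/-- The plausibility function `Pl(B) = ∑_{A ∩ B ≠ ∅} m(A)`. -/
def MassFunction.pl {n : ℕ} (m : MassFunction n) (B : Finset (Fin n)) : ℝ :=
  ∑ A ∈ Finset.univ.filter (fun A => A ∩ B ≠ ∅), m.mass A

/-- The probability vectors on `Ω` that dominate the set function `μ`. -/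
def credalSet {n : ℕ} (μ : Finset (Fin n) → ℝ) : Set (Fin n → ℝ) :=
  {p | p ∈ stdSimplex ℝ (Fin n) ∧ ∀ A, μ A ≤ ∑ i ∈ A, p i}

/-- Shannon entropy `-∑ p_i log p_i` (with `0 log 0 = 0`). -/
def entropy {n : ℕ} (p : Fin n → ℝ) : ℝ := -∑ i, p i * Real.log (p i)

/-- `h` is the upper entropy of `μ`: the maximum of the entropy over the credal set. -/
def IsUpperEntropy {n : ℕ} (μ : Finset (Fin n) → ℝ) (h : ℝ) : Prop :=
  IsGreatest (entropy '' credalSet μ) h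

/-- `A` minimizes `g` and contains every minimizer of `g`; in particular `A` is the unique
minimizer of largest cardinality. -/
def IsMaximalMinimizer {n : ℕ} (g : Finset (Fin n) → ℝ) (A : Finset (Fin n)) : Prop :=
  (∀ B, g A ≤ g B) ∧ ∀ B, (∀ D, g B ≤ g D) → B ⊆ A

/-! ### Flow networks -/

/-- A flow network on the vertex set `V` without antiparallel edges and loops. The edges are the
pairs of nonzero capacity; capacities may be infinite. -/
structure FlowNetwork (V : Type) where
  source : V
  sink : V
  source_ne_sink : source ≠ sink
  cap : V → V → ℝ≥0∞
  cap_antiparallel : ∀ u v, cap u v = 0 ∨ cap v u = 0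

/-- `f` respects the capacities and is conserved at every vertex but the source and the sink. -/
def FlowNetwork.IsFlow {V : Type} [Fintype V] (N : FlowNetwork V) (f : V → V → ℝ≥0) : Prop :=
  (∀ u v, (f u v : ℝ≥0∞) ≤ N.cap u v) ∧
    ∀ u, u ≠ N.source → u ≠ N.sink → ∑ v, f v u = ∑ v, f u v

/-- The value of a flow: net flow out of the source. -/
def FlowNetwork.value {V : Type} [Fintype V] (N : FlowNetwork V) (f : V → V → ℝ≥0) : ℝ :=
  ∑ v, (f N.source v : ℝ) - ∑ v, (f v N.source : ℝ)

def FlowNetwork.IsMaxFlow {V : Type} [Fintype V] (N : FlowNetwork V) (f : V → V → ℝ≥0) : Prop :=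
  N.IsFlow f ∧ ∀ g, N.IsFlow g → N.value g ≤ N.value f

/-- Residual capacity: `c(u,v) - f(u,v)` along an edge `(u,v)`, and otherwise `f(v,u)` (which is `0`
for a flow if `(v,u)` is not an edge either). -/
def FlowNetwork.resCap {V : Type} (N : FlowNetwork V) (f : V → V → ℝ≥0) (u v : V) : ℝ≥0∞ :=
  if N.cap u v ≠ 0 then N.cap u v - f u v else f v u

/-- `v` can be reached from `u` in the residual graph of `f`. -/
def FlowNetwork.ResReachable {V : Type} (N : FlowNetwork V) (f : V → V → ℝ≥0) (u v : V) : Prop :=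
  Relation.ReflTransGen (fun a b => 0 < N.resCap f a b) u v

/-! ### The bipartite network of a mass function -/

/-- Vertices: source `s`, left vertices (elements), right vertices (focal sets), sink `t`. -/
inductive Node {n : ℕ} (m : MassFunction n) where
  | s : Node m
  | elem (j : Fin n) : Node m
  | focal (F : {F : Finset (Fin n) // F ∈ m.focal}) : Node m
  | t : Node m
  deriving DecidableEq, Fintype

/-- `c(s,j) = α`; `c(j,F) = ∞` if `j ∈ F`; `c(F,t) = m(F)`; no other edges. -/
def nodeCap {n : ℕ} (m : MassFunction n) (α : ℝ) : Node m → Node m → ℝ≥0∞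
  | .s, .elem _ => ENNReal.ofReal α
  | .elem j, .focal F => if j ∈ F.1 then ⊤ else 0
  | .focal F, .t => ENNReal.ofReal (m.mass F.1)
  | _, _ => 0

def network {n : ℕ} (m : MassFunction n) (α : ℝ) : FlowNetwork (Node m) where
  source := .s
  sink := .t
  source_ne_sink := by simp
  cap := nodeCap m α
  cap_antiparallel := by
    intro u v
    cases u <;> cases v <;> simp [nodeCap]

open Classical in
/-- The elements whose left vertices cannot reach `t` in the residual graph of `f`. -/
def nonReaching {n : ℕ} (m : MassFunction n) (α : ℝ) (f : Node m → Node m → ℝ≥0) :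
    Finset (Fin n) :=
  Finset.univ.filter fun j => ¬ (network m α).ResReachable f (.elem j) .t

/-! ### Computations with counted operations

A step is a bounded number of elementary operations on stored data: arithmetic operations,
logarithms and comparisons of numbers, membership tests for a given element and a given set,
reading or writing one entry of a table. Sets of elements and of vertices are stored as
characteristic vectors (the initialization of a table is paid by a loop over its entries), and the
input is the list of the focal sets with their masses. -/

/-- A result, with the numbers of maximum-flow computations, of depth-first searches, and of
steps (including the steps of the maximum-flow computations and of the searches). -/
structure Counted (α : Type) where
  val : α
  flows : ℕ
  searches : ℕ
  steps : ℕ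

instance : Monad Counted where
  pure a := ⟨a, 0, 0, 0⟩
  bind x f := ⟨(f x.val).val, x.flows + (f x.val).flows, x.searches + (f x.val).searches,
    x.steps + (f x.val).steps⟩

/-- Pay for `k` steps. -/
def charge (k : ℕ) : Counted Unit := ⟨(), 0, 0, k⟩

/-- Loop over a list with a state; each round pays one step and what its body pays. -/
def loop {ι σ : Type} : List ι → σ → (σ → ι → Counted σ) → Counted σ
  | [], x, _ => pure x
  | i :: l, x, body => do
    charge 1
    let y ← body x i
    loop l y body

/-! #### Depth-first search -/

/-- Recursive depth-first search: mark `u`, then visit every unmarked neighbour in turn. The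
first argument bounds the depth of the recursion. -/
def dfsVisit {V : Type} [Fintype V] [DecidableEq V] (adj : V → V → Bool) :
    ℕ → V → Finset V → Counted (Finset V)
  | 0, _, seen => pure seen
  | k + 1, u, seen => do
    charge 1
    loop Finset.univ.toList (insert u seen) fun seen v =>
      if v ∉ seen ∧ adj u v = true then dfsVisit adj k v seen else pure seen

/-- One depth-first search from `u`; a branch of it has at most `|V|` vertices. -/
def depthFirstSearch {V : Type} [Fintype V] [DecidableEq V] (adj : V → V → Bool)
    (u : V) : Counted (Finset V) := do
  let r := dfsVisit adj (Fintype.card V) u ∅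
  ⟨r.val, r.flows, r.searches + 1, r.steps⟩

/-! #### A maximum-flow algorithm: Edmonds-Karp -/

/-- Breadth-first search of the residual graph from the source, level by level: `lab v` is the
level of `v` and its predecessor on a shortest path. -/
def bfsLabels {V : Type} [Fintype V] [DecidableEq V] (N : FlowNetwork V) (f : V → V → ℝ≥0) :
    Counted (V → Option (ℕ × V)) := do
  charge 1
  loop (List.range (Fintype.card V))
    (fun v => if v = N.source then some (0, N.source) else none) fun lab k =>
      loop Finset.univ.toList lab fun lab u =>
        loop Finset.univ.toList lab fun lab v =>
          if (lab u).map Prod.fst = some k ∧ lab v = none ∧ 0 < N.resCap f u v then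
            pure (Function.update lab v (some (k + 1, u)))
          else pure lab

/-- The last `k` edges of the path to `v` given by the predecessors, from the last edge on. -/
def pathEdges {V : Type} (lab : V → Option (ℕ × V)) : ℕ → V → Counted (List (V × V))
  | 0, _ => pure []
  | k + 1, v => do
    charge 1
    match lab v with
    | none => pure []
    | some (_, u) => do
      let l ← pathEdges lab k u
      pure ((u, v) :: l)

/-- Send `δ` along the residual edge `(u,v)`. -/
def pushEdge {V : Type} [DecidableEq V] (N : FlowNetwork V) (δ : ℝ≥0)
    (f : V → V → ℝ≥0) (u v : V) : V → V → ℝ≥0 :=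
  if N.cap u v ≠ 0 then Function.update f u (Function.update (f u) v (f u v + δ))
  else Function.update f v (Function.update (f v) u (f v u - δ))

/-- At most `k` augmentations along shortest augmenting paths. -/
def augmentLoop {V : Type} [Fintype V] [DecidableEq V] (N : FlowNetwork V) :
    ℕ → (V → V → ℝ≥0) → Counted (V → V → ℝ≥0)
  | 0, f => pure f
  | k + 1, f => do
    let lab ← bfsLabels N f
    charge 1
    match lab N.sink with
    | none => pure f
    | some (d, _) => do
      let path ← pathEdges lab d N.sink
      let δ ← loop path (⊤ : ℝ≥0∞) fun δ e => pure (min δ (N.resCap f e.1 e.2))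
      let g ← loop path f fun g e => pure (pushEdge N δ.toNNReal g e.1 e.2)
      augmentLoop N k g

/-- The Edmonds-Karp algorithm, started from the zero flow and stopped when no augmenting path is
left (or after `|V|^3` augmentations). The initialization pays for all pairs of vertices. -/
def edmondsKarp {V : Type} [Fintype V] [DecidableEq V] (N : FlowNetwork V) : Counted (V → V → ℝ≥0) := do
  charge (Fintype.card V ^ 2 + 1)
  augmentLoop N (Fintype.card V ^ 3) fun _ _ => 0

/-! #### The decomposition algorithm for a belief function -/

/-- The value `Pl(B)`, from the list of focal sets. -/
def plProg {n : ℕ} (m : MassFunction n) (B : Finset (Fin n)) : Counted ℝ :=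
  loop m.focal.toList 0 fun x F => do
    let hit ← loop (List.finRange n) false fun b j => pure (b || decide (j ∈ F ∧ j ∈ B))
    pure (if hit then x + m.mass F else x)

/-- The slope `(Pl(S') - Pl(S)) / |S' \ S|`. -/
def slopeProg {n : ℕ} (m : MassFunction n) (S S' : Finset (Fin n)) : Counted ℝ := do
  let a ← plProg m S'
  let b ← plProg m S
  let c ← loop (List.finRange n) (0 : ℝ) fun c i =>
    pure (if i ∈ S' ∧ i ∉ S then c + 1 else c)
  charge 1
  pure ((a - b) / c)

/-- Comparison of two sets, element by element. -/
def sameProg {n : ℕ} (S S' : Finset (Fin n)) : Counted Bool :=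
  loop (List.finRange n) true fun b i => pure (b && decide (i ∈ S ↔ i ∈ S'))

/-- A procedure for maximum flows in the networks of `m`: for each `α` a flow, and the number of
steps spent on it. -/
abbrev FlowSolver {n : ℕ} (m : MassFunction n) : Type := ℝ → (Node m → Node m → ℝ≥0) × ℕ

/-- One maximum-flow computation. -/
def maxFlowProg {n : ℕ} {m : MassFunction n} (mf : FlowSolver m) (α : ℝ) :
    Counted (Node m → Node m → ℝ≥0) :=
  ⟨(mf α).1, 1, 0, (mf α).2⟩

/-- The minimization step: a maximum flow, then a search from `t` against the direction of the
residual edges; the elements that it does not meet are collected. -/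
def minimizerProg {n : ℕ} {m : MassFunction n} (mf : FlowSolver m) (α : ℝ) :
    Counted (Finset (Fin n)) := do
  let f ← maxFlowProg mf α
  let seen ← depthFirstSearch (fun u v => decide (0 < (network m α).resCap f v u)) Node.t
  loop (List.finRange n) ∅ fun A j =>
    pure (if Node.elem j ∈ seen then A else insert j A)

/-- The recursive procedure `DA(S, S')` of the decomposition algorithm for `ν = Pl` and `b = 1`. The
result is the list of the pairs of consecutive members of the computed chain from `S` to `S'`.
The first argument bounds the depth of the recursion; the result is `none` if that was too small. -/
def decompose {n : ℕ} {m : MassFunction n} (mf : FlowSolver m) :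
    ℕ → Finset (Fin n) → Finset (Fin n) →
      Counted (Option (List (Finset (Fin n) × Finset (Fin n))))
  | 0, _, _ => pure none
  | k + 1, S, S' => do
    let α ← slopeProg m S S'
    let A ← minimizerProg mf α
    let b ← sameProg A S'
    if b then pure (some [(S, S')])
    else do
      let x ← decompose mf k S A
      let y ← decompose mf k A S'
      match x, y with
      | some l, some l' => do
        charge (l.length + 1)
        pure (some (l ++ l'))
      | _, _ => pure none

/-- The vector `p` with `p_i = (Pl(S') - Pl(S)) / |S' \ S|` for `i ∈ S' \ S` and consecutive members
`S ⊂ S'` of the chain. -/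
def optimalProg {n : ℕ} (m : MassFunction n) (l : List (Finset (Fin n) × Finset (Fin n))) :
    Counted (Fin n → ℝ) :=
  loop l (fun _ => 0) fun p e => do
    let q ← slopeProg m e.1 e.2
    loop (List.finRange n) p fun p i =>
      pure (if i ∈ e.2 ∧ i ∉ e.1 then Function.update p i q else p)

def entropyProg {n : ℕ} (p : Fin n → ℝ) : Counted ℝ :=
  loop (List.finRange n) 0 fun h i => pure (h - p i * Real.log (p i))

/-- The whole computation: the chain from `∅` to `Ω`, the vector `p` and its entropy. The result
is `none` if the recursion of the decomposition algorithm gets deeper than `n`. -/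
def upperEntropyProg {n : ℕ} {m : MassFunction n} (mf : FlowSolver m) :
    Counted (Option ((Fin n → ℝ) × ℝ)) := do
  let r ← decompose mf n ∅ Finset.univ
  match r with
  | none => pure none
  | some l => do
    let p ← optimalProg m l
    let h ← entropyProg p
    pure (some (p, h))

/-- The Edmonds-Karp algorithm on the networks of `m`. -/
def edmondsKarpSolver {n : ℕ} (m : MassFunction n) : FlowSolver m := fun α =>
  ((edmondsKarp (network m α)).val, (edmondsKarp (network m α)).steps)

/-- The result `r` of a computation consists of a vector in the credal set of `Bel` and of its
entropy, and this entropy is the upper entropy of `Bel`. -/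
def IsCorrectResult {n : ℕ} (m : MassFunction n) (r : Option ((Fin n → ℝ) × ℝ)) : Prop :=
  ∃ p h, r = some (p, h) ∧ p ∈ credalSet m.bel ∧ entropy p = h ∧ IsUpperEntropy m.bel h

end UpperEntropy

end

/-!
The heart of the matter is that `Pl` is monotone and submodular, and that the cuts of the network
are the values of the function to be minimized.

*Flows and minimizers.* A set `B` of elements, together with the focal sets it hits, is the source
side of a cut of capacity `Pl(B) - α |B| + n α`. `cut_sub_value` writes the gap between such a cut
and a flow as a sum of nonnegative terms (unused capacity, and flow back across the cut). Without
an augmenting path all the terms vanish for `nonReaching`; conversely, if they vanish for `B`, then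
no residual edge leaves the source side of `B`, so `B ⊆ nonReaching`. Hence `nonReaching` is the
largest minimizer.

*Maximum flows.* A maximum flow has no augmenting path since `IsLevelForest.augment` would improve
it. That the Edmonds-Karp algorithm stops in time is shown without the distance function: the levels
of a breadth-first search have tight predecessors and no residual edge skips a level, which gives
that the levels never decrease (`level_mono`). Each augmentation saturates an edge `(u, v)` with `u`
on some level `d`, and the triple `(u, v, d)` cannot occur a second time (`IsHistory.augment`), so
there are at most `|V|^3` augmentations.

*The decomposition.* Throughout the recursion `S` minimizes `Pl(A) - β |A|` for some `β`, and `S'` is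
the largest minimizer for some `β'`. The slope between `S` and `S'` then lies in `[β, β']`, and since
minimizers grow with the slope, the new set lies between `S` and `S'`; it is different from `S`
because `S` and `S'` have equal penalized values (`minimizer_between`). So the recursion makes at most
`2 n - 1` calls and ends with a chain whose consecutive members minimize for the slope between them.

*Optimality.* Submodularity and the minimality of the members of the chain show that `p` is dominated
by `Pl`, that is, dominates `Bel` (`IsPrincipalChain.sum_inter_le`). For a competitor `q`, the tangent
inequality for `x log x` at `p` reduces the comparison of the entropies to
`∑ (q_i - p_i) log p_i ≥ 0`, which follows by Abel summation from `q(S_j) ≤ Pl(S_j)` and the growth of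
the slopes (`IsPrincipalChain.entropy_bound`); on a block of slope `0` both vectors vanish.
-/

namespace UpperEntropy

/-! ### Results and costs of counted computations -/

section Counted

variable {α β ι σ : Type}

@[simp] theorem val_pure (a : α) : (pure a : Counted α).val = a := rfl
@[simp] theorem flows_pure (a : α) : (pure a : Counted α).flows = 0 := rfl
@[simp] theorem searches_pure (a : α) : (pure a : Counted α).searches = 0 := rfl
@[simp] theorem steps_pure (a : α) : (pure a : Counted α).steps = 0 := rfl

@[simp] theorem val_bind (x : Counted α) (f : α → Counted β) : (x >>= f).val = (f x.val).val := rfl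
@[simp] theorem flows_bind (x : Counted α) (f : α → Counted β) :
    (x >>= f).flows = x.flows + (f x.val).flows := rfl
@[simp] theorem searches_bind (x : Counted α) (f : α → Counted β) :
    (x >>= f).searches = x.searches + (f x.val).searches := rfl
@[simp] theorem steps_bind (x : Counted α) (f : α → Counted β) :
    (x >>= f).steps = x.steps + (f x.val).steps := rfl

@[simp] theorem flows_charge (k : ℕ) : (charge k).flows = 0 := rfl
@[simp] theorem searches_charge (k : ℕ) : (charge k).searches = 0 := rfl
@[simp] theorem steps_charge (k : ℕ) : (charge k).steps = k := rfl

theorem val_loop (l : List ι) (x : σ) (body : σ → ι → Counted σ) :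
    (loop l x body).val = l.foldl (fun x i => (body x i).val) x := by
  induction l generalizing x with
  | nil => rfl
  | cons i l ih => simp [loop, ih]

theorem flows_loop (l : List ι) (x : σ) {body : σ → ι → Counted σ}
    (h : ∀ x i, (body x i).flows = 0) : (loop l x body).flows = 0 := by
  induction l generalizing x with
  | nil => rfl
  | cons i l ih => simp [loop, ih, h]

theorem searches_loop (l : List ι) (x : σ) {body : σ → ι → Counted σ}
    (h : ∀ x i, (body x i).searches = 0) : (loop l x body).searches = 0 := by
  induction l generalizing x with
  | nil => rfl
  | cons i l ih => simp [loop, ih, h]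

theorem steps_loop_le (l : List ι) (x : σ) {body : σ → ι → Counted σ} {c : ℕ}
    (h : ∀ x i, (body x i).steps ≤ c) : (loop l x body).steps ≤ l.length * (c + 1) := by
  induction l generalizing x with
  | nil => simp [loop]
  | cons i l ih =>
    simp only [loop, steps_bind, steps_charge, List.length_cons]
    have := ih (body x i).val
    have := h x i
    linarith

/-- A fold keeps an invariant indexed by the list of the items processed so far. -/
theorem foldl_invariant {g : σ → ι → σ} (P : List ι → σ → Prop)
    (step : ∀ done x i, P done x → P (done ++ [i]) (g x i)) (l : List ι) (done : List ι) (x : σ)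
    (h : P done x) : P (done ++ l) (l.foldl g x) := by
  induction l generalizing x done with
  | nil => simpa using h
  | cons i l ih => simpa using ih (done ++ [i]) (g x i) (step done x i h)

end Counted

/-! ### Depth-first search -/

section DFS

variable {V : Type} [Fintype V] [DecidableEq V] {adj : V → V → Bool}

theorem flows_dfsVisit (k : ℕ) (u : V) (seen : Finset V) : (dfsVisit adj k u seen).flows = 0 := by
  induction k generalizing u seen with
  | zero => rfl
  | succ k ih =>
    simp only [dfsVisit, flows_bind, flows_charge, zero_add]
    refine flows_loop _ _ fun x i => ?_
    split_ifs
    · exact ih _ _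
    · rfl

theorem searches_dfsVisit (k : ℕ) (u : V) (seen : Finset V) :
    (dfsVisit adj k u seen).searches = 0 := by
  induction k generalizing u seen with
  | zero => rfl
  | succ k ih =>
    simp only [dfsVisit, searches_bind, searches_charge, zero_add]
    refine searches_loop _ _ fun x i => ?_
    split_ifs
    · exact ih _ _
    · rfl

/-- The state reached from the marked set `seen` by (a part of) a depth-first search which started
at `u`: only vertices that can be reached from `u` were marked, and the neighbours of the newly
marked vertices, those in `opn` excepted, are marked too. -/
structure DfsState (adj : V → V → Bool) (u : V) (seen opn R : Finset V) : Prop where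
  subset : seen ⊆ R
  reachable : ∀ x ∈ R, x ∉ seen → Relation.ReflTransGen (fun a b => adj a b = true) u x
  closed : ∀ x ∈ R, x ∉ seen → x ∉ opn → ∀ y, adj x y = true → y ∈ R

/-- A visit of an unmarked vertex marks it together with all it has to, as long as the recursion
depth that is left covers the unmarked vertices. Every newly marked vertex costs one pass over
the vertices. -/
theorem dfsVisit_spec (k : ℕ) (u : V) (seen : Finset V) (hu : u ∉ seen)
    (hk : Fintype.card V ≤ seen.card + k) :
    DfsState adj u seen ∅ (dfsVisit adj k u seen).val ∧ u ∈ (dfsVisit adj k u seen).val ∧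
      (dfsVisit adj k u seen).steps + seen.card * (Fintype.card V + 1) ≤
        (dfsVisit adj k u seen).val.card * (Fintype.card V + 1) := by
  induction k generalizing u seen with
  | zero =>
    have : seen.card < Fintype.card V := Finset.card_lt_univ_of_notMem hu
    omega
  | succ k ih =>
    simp only [dfsVisit, val_bind, steps_bind, steps_charge]
    set body : Finset V → V → Counted (Finset V) := fun seen v =>
      if v ∉ seen ∧ adj u v = true then dfsVisit adj k v seen else pure seen with hbody
    have key : ∀ (l : List V) (R : Finset V), insert u seen ⊆ R →
        DfsState adj u seen {u} R →
        DfsState adj u seen {u} (loop l R body).val ∧ R ⊆ (loop l R body).val ∧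
        (∀ v ∈ l, adj u v = true → v ∈ (loop l R body).val) ∧
        (loop l R body).steps + R.card * (Fintype.card V + 1) ≤
          (loop l R body).val.card * (Fintype.card V + 1) + l.length := by
      intro l
      induction l with
      | nil => intro R _ hR; exact ⟨hR, subset_rfl, by simp, by simp [loop]⟩
      | cons v l ihl =>
        intro R hsub hR
        simp only [loop, val_bind, steps_bind, steps_charge, List.length_cons]
        have hstep : DfsState adj u seen {u} (body R v).val ∧ R ⊆ (body R v).val ∧
            (adj u v = true → v ∈ (body R v).val) ∧
            (body R v).steps + R.card * (Fintype.card V + 1) ≤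
              (body R v).val.card * (Fintype.card V + 1) := by
          simp only [hbody]
          split_ifs with h
          · have hcard : seen.card + 1 ≤ R.card := by
              rw [← Finset.card_insert_of_notMem hu]
              exact Finset.card_le_card hsub
            obtain ⟨h1, h2, h3⟩ := ih v R h.1 (by omega)
            refine ⟨⟨hR.subset.trans h1.subset, ?_, ?_⟩, h1.subset, fun _ => h2, h3⟩
            · intro x hx hxs
              by_cases hxR : x ∈ R
              · exact hR.reachable x hxR hxs
              · exact .trans (.single h.2) (h1.reachable x hx hxR)
            · intro x hx hxs hxu y hy
              by_cases hxR : x ∈ R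
              · exact h1.subset (hR.closed x hxR hxs hxu y hy)
              · exact h1.closed x hx hxR (by simp) y hy
          · refine ⟨hR, subset_rfl, fun ha => ?_, by simp⟩
            by_contra hv
            exact h ⟨hv, ha⟩
        obtain ⟨s1, s2, s3, s4⟩ := hstep
        obtain ⟨t1, t2, t3, t4⟩ := ihl (body R v).val (hsub.trans s2) s1
        refine ⟨t1, s2.trans t2, ?_, by omega⟩
        intro w hw ha
        rcases List.mem_cons.1 hw with rfl | hw
        · exact t2 (s3 ha)
        · exact t3 w hw ha
    obtain ⟨t1, t2, t3, t4⟩ := key Finset.univ.toList (insert u seen) subset_rfl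
      ⟨Finset.subset_insert _ _, by
        intro x hx hxs
        rcases Finset.mem_insert.1 hx with rfl | hx
        · exact .refl
        · exact absurd hx hxs, by
        intro x hx hxs hxu
        rcases Finset.mem_insert.1 hx with rfl | hx
        · simp at hxu
        · exact absurd hx hxs⟩
    refine ⟨⟨t1.subset, t1.reachable, ?_⟩, t2 (Finset.mem_insert_self _ _), ?_⟩
    · intro x hx hxs _ y hy
      by_cases hxu : x = u
      · exact t3 y (by simp) (hxu ▸ hy)
      · exact t1.closed x hx hxs (by simpa using hxu) y hy
    · rw [Finset.card_insert_of_notMem hu] at t4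
      simp only [Finset.length_toList, Finset.card_univ] at t4
      linarith

theorem mem_depthFirstSearch {u x : V} : x ∈ (depthFirstSearch adj u).val ↔
    Relation.ReflTransGen (fun a b => adj a b = true) u x := by
  obtain ⟨h1, h2, -⟩ := dfsVisit_spec (adj := adj) (Fintype.card V) u ∅ (by simp) (by simp)
  constructor
  · exact fun hx => h1.reachable x hx (by simp)
  · intro h
    induction h with
    | refl => exact h2
    | tail _ hab ih => exact h1.closed _ ih (by simp) (by simp) _ hab

theorem flows_depthFirstSearch (u : V) : (depthFirstSearch adj u).flows = 0 :=
  flows_dfsVisit _ _ _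

theorem searches_depthFirstSearch (u : V) : (depthFirstSearch adj u).searches = 1 := by
  simp [depthFirstSearch, searches_dfsVisit]

theorem steps_depthFirstSearch_le (u : V) :
    (depthFirstSearch adj u).steps ≤ Fintype.card V * (Fintype.card V + 1) := by
  obtain ⟨-, -, h⟩ := dfsVisit_spec (adj := adj) (Fintype.card V) u ∅ (by simp) (by simp)
  have := Nat.mul_le_mul_right (Fintype.card V + 1)
    (Finset.card_le_univ (dfsVisit adj (Fintype.card V) u ∅).val)
  simp only [Finset.card_empty, zero_mul, add_zero] at h
  exact h.trans this

end DFS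

/-! ### Breadth-first labellings of the residual graph -/

section Labelling

variable {V : Type} {N : FlowNetwork V} {f : V → V → ℝ≥0} {lab : V → Option (ℕ × V)}

/-- The level of a vertex in a labelling, infinite for the vertices without a label. -/
def level (lab : V → Option (ℕ × V)) (v : V) : ℕ∞ := (lab v).elim ⊤ fun x => x.1

theorem level_of_eq_some {v p : V} {d : ℕ} (h : lab v = some (d, p)) : level lab v = d := by
  simp [level, h]

theorem level_of_eq_none {v : V} (h : lab v = none) : level lab v = ⊤ := by
  simp [level, h]

theorem exists_of_level_eq {v : V} {d : ℕ} (h : level lab v = d) : ∃ p, lab v = some (d, p) := by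
  rcases hv : lab v with _ | ⟨d', p⟩
  · simp [level, hv] at h
  · rw [level_of_eq_some hv, Nat.cast_inj] at h
    exact ⟨p, by rw [h]⟩

/-- `lab` labels the source with level `0`, and every other labelled vertex has a predecessor on
the level before it. -/
structure IsLevelForest (N : FlowNetwork V) (f : V → V → ℝ≥0) (lab : V → Option (ℕ × V)) :
    Prop where
  source : lab N.source = some (0, N.source)
  pred : ∀ v d p, lab v = some (d, p) →
    (d = 0 ∧ v = N.source) ∨ ∃ d' q, d = d' + 1 ∧ lab p = some (d', q) ∧ 0 < N.resCap f p v

/-- In addition, no residual edge leads more than one level further. Hence the levels are the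
distances from the source; these two properties are all that is needed of distances. -/
structure IsBfsLabelling (N : FlowNetwork V) (f : V → V → ℝ≥0) (lab : V → Option (ℕ × V)) : Prop
    extends IsLevelForest N f lab where
  edge : ∀ u v, 0 < N.resCap f u v → level lab v ≤ level lab u + 1

theorem IsLevelForest.pred_succ (h : IsLevelForest N f lab) {v p : V} {d : ℕ}
    (hv : lab v = some (d + 1, p)) : ∃ q, lab p = some (d, q) ∧ 0 < N.resCap f p v := by
  rcases h.pred v _ p hv with h0 | ⟨d', q, h1, h2⟩
  · omega
  · obtain rfl : d = d' := by omega
    exact ⟨q, h2⟩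

theorem IsLevelForest.level_lt_card [Fintype V] (h : IsLevelForest N f lab) {v p : V} {d : ℕ}
    (hv : lab v = some (d, p)) : d < Fintype.card V := by
  classical
  -- the predecessors of `v` occupy all smaller levels
  have key : ∀ d v p, lab v = some (d, p) →
      ∃ s : Finset V, s.card = d + 1 ∧ ∀ x ∈ s, level lab x ≤ d := by
    intro d
    induction d with
    | zero => exact fun v p hv => ⟨{v}, by simp, by simp [level_of_eq_some hv]⟩
    | succ d ih =>
      intro v p hv
      obtain ⟨q, hq, -⟩ := h.pred_succ hv
      obtain ⟨s, hs, hl⟩ := ih p q hq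
      have hvs : v ∉ s := fun hmem => by
        have := hl v hmem
        rw [level_of_eq_some hv, Nat.cast_le] at this
        omega
      refine ⟨insert v s, by rw [Finset.card_insert_of_notMem hvs, hs], fun x hx => ?_⟩
      rcases Finset.mem_insert.1 hx with rfl | hx
      · exact (level_of_eq_some hv).le
      · exact (hl x hx).trans (by exact_mod_cast d.le_succ)
  obtain ⟨s, hs, -⟩ := key d v p hv
  have := s.card_le_univ
  omega

theorem IsBfsLabelling.level_ne_top (h : IsBfsLabelling N f lab) {v : V}
    (hv : N.ResReachable f N.source v) : level lab v ≠ ⊤ := by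
  induction hv with
  | refl => simp [level_of_eq_some h.source]
  | tail _ hab ih =>
    exact ne_top_of_le_ne_top (by simpa using ih) (h.edge _ _ hab)

end Labelling

section Bfs

variable {V : Type} {N : FlowNetwork V} {f : V → V → ℝ≥0}

/-- The state of the breadth-first search while the edges out of level `k` are scanned; `D` is the
set of the pairs scanned so far. -/
structure BfsState (N : FlowNetwork V) (f : V → V → ℝ≥0) (k : ℕ) (D : V → V → Prop)
    (lab : V → Option (ℕ × V)) : Prop extends IsLevelForest N f lab where
  edge : ∀ u v d p, lab u = some (d, p) → (d < k ∨ d = k ∧ D u v) → 0 < N.resCap f u v →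
    level lab v ≤ d + 1
  bound : ∀ v d p, lab v = some (d, p) → d ≤ k + 1

theorem BfsState.mono {k : ℕ} {D D' : V → V → Prop} {lab : V → Option (ℕ × V)}
    (h : BfsState N f k D lab) (hD : ∀ a b, D' a b → D a b) : BfsState N f k D' lab :=
  ⟨h.toIsLevelForest,
    fun u v d p hu hd => h.edge u v d p hu (hd.imp_right fun x => ⟨x.1, hD _ _ x.2⟩), h.bound⟩

variable [DecidableEq V]

theorem BfsState.scan {k : ℕ} {D : V → V → Prop} {lab : V → Option (ℕ × V)}
    (h : BfsState N f k D lab) (u v : V) :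
    BfsState N f k (fun a b => D a b ∨ a = u ∧ b = v)
      (if (lab u).map Prod.fst = some k ∧ lab v = none ∧ 0 < N.resCap f u v then
        Function.update lab v (some (k + 1, u)) else lab) := by
  split_ifs with hc
  · obtain ⟨h1, h2, h3⟩ := hc
    obtain ⟨⟨k', p₀⟩, hu, hk⟩ := Option.map_eq_some_iff.1 h1
    obtain rfl : k' = k := hk
    have hne : ∀ x y, lab x = some y → x ≠ v := by
      rintro x y hx rfl
      simp [h2] at hx
    have hlev : ∀ x (d : ℕ), level lab x ≤ d →
        level (Function.update lab v (some (k' + 1, u))) x ≤ d := by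
      intro x d hx
      have : x ≠ v := by
        rintro rfl
        simp [level_of_eq_none h2] at hx
      simpa [level, Function.update_of_ne this] using hx
    refine ⟨⟨?_, ?_⟩, ?_, ?_⟩
    · rw [Function.update_of_ne (hne _ _ h.source), h.source]
    · intro x d p hx
      by_cases hxv : x = v
      · subst hxv
        simp only [Function.update_self, Option.some.injEq, Prod.mk.injEq] at hx
        obtain ⟨rfl, rfl⟩ := hx
        exact .inr ⟨k', p₀, rfl, by rw [Function.update_of_ne (hne _ _ hu), hu], h3⟩
      · rw [Function.update_of_ne hxv] at hx
        refine (h.pred x d p hx).imp_right ?_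
        rintro ⟨d', q, hd, hp, hr⟩
        exact ⟨d', q, hd, by rw [Function.update_of_ne (hne _ _ hp), hp], hr⟩
    · intro a b d p ha hd hr
      have hav : a ≠ v := by
        rintro rfl
        simp only [Function.update_self, Option.some.injEq, Prod.mk.injEq] at ha
        omega
      rw [Function.update_of_ne hav] at ha
      rcases hd with hd | ⟨hd, hD | ⟨rfl, rfl⟩⟩
      · exact_mod_cast hlev b (d + 1) (by exact_mod_cast h.edge a b d p ha (.inl hd) hr)
      · exact_mod_cast hlev b (d + 1) (by exact_mod_cast h.edge a b d p ha (.inr ⟨hd, hD⟩) hr)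
      · simp [level, hd]
    · intro x d p hx
      by_cases hxv : x = v
      · subst hxv
        simp only [Function.update_self, Option.some.injEq, Prod.mk.injEq] at hx
        omega
      · rw [Function.update_of_ne hxv] at hx
        exact h.bound x d p hx
  · refine ⟨h.toIsLevelForest, ?_, h.bound⟩
    rintro a b d p ha (hd | ⟨hd, hD | ⟨rfl, rfl⟩⟩) hr
    · exact h.edge a b d p ha (.inl hd) hr
    · exact h.edge a b d p ha (.inr ⟨hd, hD⟩) hr
    · rcases hb : lab b with _ | ⟨d', q⟩
      · exact absurd ⟨by simp [ha, hd], hb, hr⟩ hc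
      · rw [level_of_eq_some hb, hd]
        exact_mod_cast h.bound b d' q hb

variable [Fintype V]

theorem isBfsLabelling_bfsLabels (N : FlowNetwork V) (f : V → V → ℝ≥0) :
    IsBfsLabelling N f (bfsLabels N f).val := by
  simp only [bfsLabels, val_bind, val_loop, apply_ite Counted.val, val_pure]
  set lab₀ : V → Option (ℕ × V) := fun v => if v = N.source then some (0, N.source) else none
  have h₀ : BfsState N f 0 (fun _ _ => False) lab₀ := by
    have hl : ∀ v d p, lab₀ v = some (d, p) → d = 0 ∧ v = N.source := by
      intro v d p hv
      by_cases hs : v = N.source <;> simp [lab₀, hs] at hv ⊢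
      exact hv.1.symm
    refine ⟨⟨by simp [lab₀], fun v d p hv => .inl (hl v d p hv)⟩, ?_, ?_⟩
    · rintro u v d p hu (hd | ⟨-, h⟩)
      · omega
      · exact h.elim
    · intro v d p hv
      have := (hl v d p hv).1
      omega
  have row : ∀ (k : ℕ) (u : V) (D : V → V → Prop) (lab : V → Option (ℕ × V)),
      BfsState N f k D lab → BfsState N f k (fun a b => D a b ∨ a = u)
        (Finset.univ.toList.foldl (fun lab v =>
          if (lab u).map Prod.fst = some k ∧ lab v = none ∧ 0 < N.resCap f u v then
            Function.update lab v (some (k + 1, u)) else lab) lab) := by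
    intro k u D lab h
    refine (foldl_invariant
      (fun done lab => BfsState N f k (fun a b => D a b ∨ a = u ∧ b ∈ done) lab)
      ?_ Finset.univ.toList [] lab (h.mono (by simp))).mono (by simp)
    intro done lab v h
    refine (h.scan u v).mono fun a b => ?_
    simp only [List.mem_append, List.mem_singleton]
    tauto
  have round : ∀ (k : ℕ) (lab : V → Option (ℕ × V)),
      BfsState N f k (fun _ _ => False) lab → BfsState N f (k + 1) (fun _ _ => False)
        (Finset.univ.toList.foldl (fun lab u => Finset.univ.toList.foldl (fun lab v =>
          if (lab u).map Prod.fst = some k ∧ lab v = none ∧ 0 < N.resCap f u v then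
            Function.update lab v (some (k + 1, u)) else lab) lab) lab) := by
    intro k lab h
    have := foldl_invariant (fun done lab => BfsState N f k (fun a _ => a ∈ done) lab)
      (fun done lab u h => (row k u _ lab h).mono fun a b => by simp)
      Finset.univ.toList [] lab (h.mono (by simp))
    refine ⟨this.toIsLevelForest, ?_, fun v d p hv => (this.bound v d p hv).trans (by omega)⟩
    rintro u v d p hu (hd | ⟨-, hF⟩) hr
    · exact this.edge u v d p hu (by simp; omega) hr
    · exact hF.elim
  have all : ∀ (K : ℕ), BfsState N f K (fun _ _ => False)
      ((List.range K).foldl (fun lab k =>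
        Finset.univ.toList.foldl (fun lab u => Finset.univ.toList.foldl (fun lab v =>
          if (lab u).map Prod.fst = some k ∧ lab v = none ∧ 0 < N.resCap f u v then
            Function.update lab v (some (k + 1, u)) else lab) lab) lab) lab₀) := by
    intro K
    induction K with
    | zero => exact h₀
    | succ K ih =>
      rw [List.range_succ, List.foldl_append]
      exact round K _ ih
  have hfin := all (Fintype.card V)
  refine ⟨hfin.toIsLevelForest, fun u v hr => ?_⟩
  rcases hu : level _ u with _ | d
  · exact le_top
  · obtain ⟨p, hp⟩ := exists_of_level_eq hu
    exact hfin.edge u v d p hp (.inl (hfin.level_lt_card hp)) hr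

theorem steps_bfsLabels_le (N : FlowNetwork V) (f : V → V → ℝ≥0) :
    (bfsLabels N f).steps ≤
      1 + Fintype.card V * (Fintype.card V * (Fintype.card V * 1 + 1) + 1) := by
  simp only [bfsLabels, steps_bind, steps_charge]
  refine Nat.add_le_add_left ?_ 1
  refine (steps_loop_le _ _ (fun lab k => steps_loop_le _ _ fun lab u =>
    steps_loop_le (c := 0) _ _ fun lab v => ?_)).trans ?_
  · split_ifs <;> simp
  · simp

end Bfs

/-! ### Augmentation along a shortest path -/

section Paths

variable {V : Type} {N : FlowNetwork V} {f : V → V → ℝ≥0} {lab : V → Option (ℕ × V)}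

theorem val_pathEdges_succ {k d : ℕ} {u v : V} (h : lab v = some (d, u)) :
    (pathEdges lab (k + 1) v).val = (u, v) :: (pathEdges lab k u).val := by
  simp [pathEdges, h]

theorem length_pathEdges_le (lab : V → Option (ℕ × V)) (k : ℕ) (v : V) :
    (pathEdges lab k v).val.length ≤ k := by
  induction k generalizing v with
  | zero => simp [pathEdges]
  | succ k ih =>
    rcases h : lab v with _ | ⟨d, u⟩
    · simp [pathEdges, h]
    · simp [val_pathEdges_succ h, ih]

theorem steps_pathEdges_le (lab : V → Option (ℕ × V)) (k : ℕ) (v : V) :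
    (pathEdges lab k v).steps ≤ k := by
  induction k generalizing v with
  | zero => simp [pathEdges]
  | succ k ih =>
    rcases h : lab v with _ | ⟨d, u⟩
    · simp [pathEdges, h]
    · simp only [pathEdges, h, steps_bind, steps_charge, steps_pure]
      have := ih u
      omega

/-- The edges of a shortest path are residual edges and lead from a level to the next one. -/
theorem IsLevelForest.of_mem_pathEdges (h : IsLevelForest N f lab) {k : ℕ} {v p : V}
    (hv : lab v = some (k, p)) {e : V × V} (he : e ∈ (pathEdges lab k v).val) :
    ∃ d : ℕ, level lab e.1 = d ∧ level lab e.2 = (d + 1 : ℕ) ∧ d + 1 ≤ k ∧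
      0 < N.resCap f e.1 e.2 := by
  induction k generalizing v p with
  | zero => simp [pathEdges] at he
  | succ k ih =>
    obtain ⟨q, hp, hr⟩ := h.pred_succ hv
    rw [val_pathEdges_succ hv] at he
    rcases List.mem_cons.1 he with rfl | he
    · exact ⟨k, level_of_eq_some hp, level_of_eq_some hv, le_rfl, hr⟩
    · obtain ⟨d, h1, h2, h3, h4⟩ := ih hp he
      exact ⟨d, h1, h2, by omega, h4⟩

/-- A path to a level other than `0` has an edge out of the source. -/
theorem IsLevelForest.exists_source_edge (h : IsLevelForest N f lab) {k : ℕ} {v p : V}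
    (hv : lab v = some (k + 1, p)) : ∃ w, (N.source, w) ∈ (pathEdges lab (k + 1) v).val := by
  induction k generalizing v p with
  | zero =>
    obtain ⟨q, hp, -⟩ := h.pred_succ hv
    rcases h.pred p 0 q hp with ⟨-, rfl⟩ | ⟨d, _, h0, -⟩
    · exact ⟨v, by simp [val_pathEdges_succ hv]⟩
    · omega
  | succ k ih =>
    obtain ⟨q, hp, -⟩ := h.pred_succ hv
    obtain ⟨w, hw⟩ := ih hp
    exact ⟨w, by rw [val_pathEdges_succ hv]; exact List.mem_cons_of_mem _ hw⟩

/-- The least residual capacity on a list of edges. -/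
noncomputable def bottleneck (N : FlowNetwork V) (f : V → V → ℝ≥0) (L : List (V × V)) : ℝ≥0∞ :=
  L.foldl (fun δ e => min δ (N.resCap f e.1 e.2)) ⊤

theorem foldl_min_spec {ι : Type} (g : ι → ℝ≥0∞) (L : List ι) (x : ℝ≥0∞) :
    L.foldl (fun δ e => min δ (g e)) x ≤ x ∧
      (∀ e ∈ L, L.foldl (fun δ e => min δ (g e)) x ≤ g e) ∧
      (L.foldl (fun δ e => min δ (g e)) x = x ∨
        ∃ e ∈ L, L.foldl (fun δ e => min δ (g e)) x = g e) := by
  induction L generalizing x with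
  | nil => simp
  | cons e L ih =>
    obtain ⟨h1, h2, h3⟩ := ih (min x (g e))
    simp only [List.foldl_cons, List.mem_cons, forall_eq_or_imp]
    refine ⟨h1.trans (min_le_left _ _), ⟨h1.trans (min_le_right _ _), h2⟩, ?_⟩
    rcases h3 with h3 | ⟨e', he', h3⟩
    · rcases min_choice x (g e) with h | h
      · exact .inl (h3.trans h)
      · exact .inr ⟨e, .inl rfl, h3.trans h⟩
    · exact .inr ⟨e', .inr he', h3⟩

theorem bottleneck_le {L : List (V × V)} {e : V × V} (he : e ∈ L) :
    bottleneck N f L ≤ N.resCap f e.1 e.2 :=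
  (foldl_min_spec (fun e : V × V => N.resCap f e.1 e.2) L ⊤).2.1 e he

theorem exists_bottleneck_eq {L : List (V × V)} (h : bottleneck N f L ≠ ⊤) :
    ∃ e ∈ L, bottleneck N f L = N.resCap f e.1 e.2 :=
  (foldl_min_spec (fun e : V × V => N.resCap f e.1 e.2) L ⊤).2.2.resolve_left h

variable [DecidableEq V]

theorem pushEdge_of_cap_ne {u v : V} (h : N.cap u v ≠ 0) (δ : ℝ≥0) (a b : V) :
    pushEdge N δ f u v a b = if a = u ∧ b = v then f u v + δ else f a b := by
  simp only [pushEdge, h, if_true, ne_eq, not_false_eq_true, Function.update_apply]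
  grind

theorem pushEdge_of_cap_eq {u v : V} (h : N.cap u v = 0) (δ : ℝ≥0) (a b : V) :
    pushEdge N δ f u v a b = if a = v ∧ b = u then f v u - δ else f a b := by
  simp only [pushEdge, h, ne_eq, not_true_eq_false, if_false, Function.update_apply]
  grind

theorem pushEdge_of_ne {u v a b : V} (δ : ℝ≥0) (h1 : ¬ (a = u ∧ b = v)) (h2 : ¬ (a = v ∧ b = u)) :
    pushEdge N δ f u v a b = f a b := by
  by_cases h : N.cap u v = 0
  · simp [pushEdge_of_cap_eq h, h2]
  · simp [pushEdge_of_cap_ne h, h1]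

omit [DecidableEq V] in
theorem resCap_congr {g : V → V → ℝ≥0} {a b : V} (h1 : g a b = f a b) (h2 : g b a = f b a) :
    N.resCap g a b = N.resCap f a b := by
  simp [FlowNetwork.resCap, h1, h2]

theorem resCap_pushEdge_self (u v : V) (δ : ℝ≥0) :
    N.resCap (pushEdge N δ f u v) u v = N.resCap f u v - δ := by
  by_cases h : N.cap u v = 0
  · simp [FlowNetwork.resCap, pushEdge_of_cap_eq h, h]
  · simp [FlowNetwork.resCap, pushEdge_of_cap_ne h, h, tsub_add_eq_tsub_tsub]

theorem pushEdge_le_cap {u v : V} {δ : ℝ≥0} (hf : ∀ a b, (f a b : ℝ≥0∞) ≤ N.cap a b)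
    (hδ : (δ : ℝ≥0∞) ≤ N.resCap f u v) (a b : V) : (pushEdge N δ f u v a b : ℝ≥0∞) ≤ N.cap a b := by
  by_cases h : N.cap u v = 0
  · rw [pushEdge_of_cap_eq h]
    split_ifs with hab
    · obtain ⟨rfl, rfl⟩ := hab
      exact le_trans (by exact_mod_cast tsub_le_self) (hf a b)
    · exact hf a b
  · rw [pushEdge_of_cap_ne h]
    split_ifs with hab
    · obtain ⟨rfl, rfl⟩ := hab
      simp only [FlowNetwork.resCap, ne_eq, h, not_false_eq_true, if_true] at hδ
      rw [ENNReal.coe_add]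
      exact (add_le_add le_rfl hδ).trans (add_tsub_cancel_of_le (hf a b)).le
    · exact hf a b

variable [Fintype V]

/-- The net flow into the vertex `x`. -/
def netFlow (f : V → V → ℝ≥0) (x : V) : ℝ := ∑ v, (f v x : ℝ) - ∑ v, (f x v : ℝ)

theorem netFlow_pushEdge {u v : V} {δ : ℝ≥0} (hδ : (δ : ℝ≥0∞) ≤ N.resCap f u v) (x : V) :
    netFlow (pushEdge N δ f u v) x =
      netFlow f x + δ * ((if x = v then 1 else 0) - (if x = u then 1 else 0)) := by
  by_cases h : N.cap u v = 0
  · have hle : δ ≤ f v u := by simpa [FlowNetwork.resCap, h] using hδ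
    have key : ∀ a b, (pushEdge N δ f u v a b : ℝ) =
        f a b - if a = v then (if b = u then (δ : ℝ) else 0) else 0 := by
      intro a b
      rw [pushEdge_of_cap_eq h]
      split_ifs <;> simp_all
    simp only [netFlow, key, Finset.sum_sub_distrib]
    split_ifs <;> simp_all <;> ring
  · have key : ∀ a b, (pushEdge N δ f u v a b : ℝ) =
        f a b + if a = u then (if b = v then (δ : ℝ) else 0) else 0 := by
      intro a b
      rw [pushEdge_of_cap_ne h]
      split_ifs <;> simp_all
    simp only [netFlow, key, Finset.sum_add_distrib]
    split_ifs <;> simp_all <;> ring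

/-- Sending `δ` along a shortest path. The levels show that the edges of the path do not interfere
with each other. -/
theorem IsLevelForest.push_pathEdges (hlab : IsLevelForest N f lab) {δ : ℝ≥0} {k : ℕ} {v p : V}
    (hv : lab v = some (k, p)) (h : V → V → ℝ≥0) (hcap : ∀ a b, (h a b : ℝ≥0∞) ≤ N.cap a b)
    (hδ : ∀ e ∈ (pathEdges lab k v).val, (δ : ℝ≥0∞) ≤ N.resCap h e.1 e.2) {g : V → V → ℝ≥0}
    (hg : g = (pathEdges lab k v).val.foldl (fun g e => pushEdge N δ g e.1 e.2) h) :
    (∀ a b, (g a b : ℝ≥0∞) ≤ N.cap a b) ∧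
    (∀ x, netFlow g x =
      netFlow h x + δ * ((if x = v then 1 else 0) - (if x = N.source then 1 else 0))) ∧
    (∀ a b, (a, b) ∉ (pathEdges lab k v).val → (b, a) ∉ (pathEdges lab k v).val →
      g a b = h a b) ∧
    (∀ e ∈ (pathEdges lab k v).val, N.resCap g e.1 e.2 = N.resCap h e.1 e.2 - δ) := by
  induction k generalizing v p h with
  | zero =>
    obtain rfl : v = N.source := by
      rcases hlab.pred v 0 p hv with h0 | ⟨d', _, h0, -⟩
      · exact h0.2
      · omega
    simp [pathEdges] at hg
    subst hg
    exact ⟨hcap, by simp, by simp, by simp [pathEdges]⟩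
  | succ k ih =>
    obtain ⟨q, hp, -⟩ := hlab.pred_succ hv
    rw [val_pathEdges_succ hv] at hδ hg ⊢
    have hne : ∀ e ∈ (pathEdges lab k p).val, e.1 ≠ v ∧ e.2 ≠ v := by
      intro e he
      obtain ⟨d, h1, h2, h3, -⟩ := hlab.of_mem_pathEdges hp he
      have hl := level_of_eq_some hv
      constructor <;> rintro rfl
      · rw [hl, Nat.cast_inj] at h1
        omega
      · rw [hl, Nat.cast_inj] at h2
        omega
    have hself := hδ (p, v) (by simp)
    have hres : ∀ e ∈ (pathEdges lab k p).val,
        N.resCap (pushEdge N δ h p v) e.1 e.2 = N.resCap h e.1 e.2 := by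
      intro e he
      obtain ⟨h1, h2⟩ := hne e he
      exact resCap_congr (pushEdge_of_ne _ (by tauto) (by tauto))
        (pushEdge_of_ne _ (by tauto) (by tauto))
    obtain ⟨i1, i2, i3, i4⟩ := ih hp (pushEdge N δ h p v) (pushEdge_le_cap hcap hself)
      (fun e he => by rw [hres e he]; exact hδ e (List.mem_cons_of_mem _ he))
      (by simpa using hg)
    refine ⟨i1, fun x => ?_, fun a b hab hba => ?_, fun e he => ?_⟩
    · rw [i2, netFlow_pushEdge hself]
      ring
    · simp only [List.mem_cons, Prod.mk.injEq, not_or] at hab hba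
      rw [i3 a b hab.2 hba.2, pushEdge_of_ne _ hab.1 (by tauto)]
    · rcases List.mem_cons.1 he with rfl | he
      · rw [← resCap_pushEdge_self]
        exact resCap_congr (i3 _ _ (fun hm => (hne _ hm).2 rfl) (fun hm => (hne _ hm).1 rfl))
          (i3 _ _ (fun hm => (hne _ hm).1 rfl) (fun hm => (hne _ hm).2 rfl))
      · rw [i4 e he, hres e he]

omit [DecidableEq V] in
theorem netFlow_eq_zero (hf : N.IsFlow f) {x : V} (h1 : x ≠ N.source) (h2 : x ≠ N.sink) :
    netFlow f x = 0 := by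
  have := hf.2 x h1 h2
  rw [netFlow, sub_eq_zero]
  exact_mod_cast this

/-- Augmentation along a shortest path to the sink gives a flow of larger value; some edge of the
path disappears from the residual graph, and only reversed edges of the path can be new there. -/
theorem IsLevelForest.augment (hlab : IsLevelForest N f lab) (hf : N.IsFlow f)
    (hs : ∀ v, N.cap N.source v ≠ ⊤) {d : ℕ} {p : V} (hd : lab N.sink = some (d, p))
    {L : List (V × V)} (hL : L = (pathEdges lab d N.sink).val) {g : V → V → ℝ≥0}
    (hg : g = L.foldl (fun g e => pushEdge N (bottleneck N f L).toNNReal g e.1 e.2) f) :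
    N.IsFlow g ∧ N.value f < N.value g ∧
      (∃ e ∈ L, N.resCap g e.1 e.2 = 0) ∧
      ∀ a b, 0 < N.resCap g a b → 0 < N.resCap f a b ∨ (b, a) ∈ L := by
  obtain ⟨k, rfl⟩ : ∃ k, d = k + 1 := by
    cases d with
    | succ k => exact ⟨k, rfl⟩
    | zero =>
      rcases hlab.pred _ 0 p hd with h0 | ⟨d', _, h0, -⟩
      · exact absurd h0.2.symm N.source_ne_sink
      · omega
  have hfin : bottleneck N f L ≠ ⊤ := by
    obtain ⟨w, hw⟩ := hlab.exists_source_edge hd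
    rw [← hL] at hw
    refine ne_top_of_le_ne_top ?_ (bottleneck_le hw)
    simp only [FlowNetwork.resCap]
    split_ifs
    · exact ne_top_of_le_ne_top (hs w) tsub_le_self
    · exact ENNReal.coe_ne_top
  obtain ⟨e, he, hbe⟩ := exists_bottleneck_eq hfin
  have hpos : 0 < bottleneck N f L := by
    rw [hbe]
    obtain ⟨_, -, -, -, h⟩ := hlab.of_mem_pathEdges hd (hL ▸ he)
    exact h
  set δ := (bottleneck N f L).toNNReal with hδ
  have hcoe : (δ : ℝ≥0∞) = bottleneck N f L := ENNReal.coe_toNNReal hfin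
  have hδpos : (0 : ℝ) < δ := by
    rw [← hcoe] at hpos
    exact_mod_cast hpos
  obtain ⟨c1, c2, c3, c4⟩ := hlab.push_pathEdges (δ := δ) (g := g) hd f hf.1
    (fun e he => by rw [hcoe]; exact bottleneck_le (hL ▸ he)) (by rw [hg, hL])
  rw [← hL] at c3 c4
  refine ⟨⟨c1, fun u h1 h2 => ?_⟩, ?_, ⟨e, he, ?_⟩, fun a b hab => ?_⟩
  · have := c2 u
    rw [netFlow_eq_zero hf h1 h2, if_neg h1, if_neg h2, netFlow] at this
    simp only [sub_zero, mul_zero, add_zero, sub_eq_zero] at this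
    exact_mod_cast this
  · have := c2 N.source
    rw [if_neg N.source_ne_sink, if_pos rfl, netFlow, netFlow] at this
    simp only [FlowNetwork.value]
    linarith
  · rw [c4 e he, hcoe, hbe, tsub_self]
  · by_contra! hcon
    obtain ⟨h1, h2⟩ := hcon
    refine hab.ne' ?_
    by_cases hm : (a, b) ∈ L
    · rw [c4 _ hm, nonpos_iff_eq_zero.1 h1, zero_tsub]
    · rw [resCap_congr (c3 a b hm h2) (c3 b a h2 hm)]
      exact nonpos_iff_eq_zero.1 h1

end Paths

/-! ### The Edmonds-Karp algorithm -/

section EdmondsKarp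

variable {V : Type} [Fintype V] [DecidableEq V] {N : FlowNetwork V} {f : V → V → ℝ≥0}

/-- The sink of a maximum flow cannot be reached in the residual graph. -/
theorem not_resReachable_of_isMaxFlow (hs : ∀ v, N.cap N.source v ≠ ⊤) (hf : N.IsMaxFlow f) :
    ¬ N.ResReachable f N.source N.sink := by
  intro h
  have hlab := isBfsLabelling_bfsLabels N f
  obtain ⟨d, hd⟩ := ENat.ne_top_iff_exists.1 (hlab.level_ne_top h)
  obtain ⟨p, hp⟩ := exists_of_level_eq hd.symm
  obtain ⟨h1, h2, -⟩ := hlab.augment hf.1 hs hp rfl rfl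
  exact absurd (hf.2 _ h1) h2.not_ge

omit [Fintype V] [DecidableEq V] in
/-- If the new residual edges of `g` are reversed edges of a shortest path for `f`, then no level
decreases. -/
theorem level_mono {g : V → V → ℝ≥0} {lab lab' : V → Option (ℕ × V)} {L : List (V × V)}
    (hlab : IsBfsLabelling N f lab) (hlab' : IsBfsLabelling N g lab')
    (hL : ∀ e ∈ L, level lab e.2 = level lab e.1 + 1)
    (hres : ∀ a b, 0 < N.resCap g a b → 0 < N.resCap f a b ∨ (b, a) ∈ L) (v : V) :
    level lab v ≤ level lab' v := by
  have key : ∀ (d : ℕ) v p, lab' v = some (d, p) → level lab v ≤ d := by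
    intro d
    induction d with
    | zero =>
      intro v p hv
      rcases hlab'.pred v 0 p hv with ⟨-, rfl⟩ | ⟨d', _, h0, -⟩
      · exact (level_of_eq_some hlab.source).le
      · omega
    | succ d ih =>
      intro v p hv
      obtain ⟨q, hq, hr⟩ := hlab'.pred_succ hv
      have hp := ih p q hq
      have hle : level lab v ≤ level lab p + 1 := by
        rcases hres p v hr with h | h
        · exact hlab.edge p v h
        · have := hL _ h
          simp only at this
          rw [this, add_assoc]
          exact le_self_add
      push_cast
      exact hle.trans (add_le_add_left hp 1)
  rcases hv : lab' v with _ | ⟨d, p⟩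
  · simp [level_of_eq_none hv]
  · rw [level_of_eq_some hv]
    exact key d v p hv

/-- The record of the earlier augmentations of a run of the algorithm: an entry `(u, v, d)` says
that the edge `(u, v)` was saturated when `u` was on level `d`, hence `v` on level `d + 1`. Should the edge
ever be back in the residual graph, then `u` has moved to a higher level: the edge can only come back
by an augmentation through `(v, u)`. -/
def IsHistory (N : FlowNetwork V) (f : V → V → ℝ≥0) (lab : V → Option (ℕ × V))
    (H : Finset (V × V × Fin (Fintype.card V))) : Prop :=
  ∀ x ∈ H, ((x.2.2 : ℕ) : ℕ∞) < level lab x.2.1 ∧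
    (0 < N.resCap f x.1 x.2.1 → ((x.2.2 : ℕ) : ℕ∞) < level lab x.1)

theorem IsHistory.augment {lab lab' : V → Option (ℕ × V)} {g : V → V → ℝ≥0}
    {H : Finset (V × V × Fin (Fintype.card V))} (hH : IsHistory N f lab H)
    (hlab : IsBfsLabelling N f lab) (hlab' : IsBfsLabelling N g lab') {d : ℕ} {p : V}
    (hd : lab N.sink = some (d, p)) {L : List (V × V)} (hL : L = (pathEdges lab d N.sink).val)
    (hcrit : ∃ e ∈ L, N.resCap g e.1 e.2 = 0)
    (hres : ∀ a b, 0 < N.resCap g a b → 0 < N.resCap f a b ∨ (b, a) ∈ L) :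
    ∃ H', IsHistory N g lab' H' ∧ H.card < H'.card := by
  have hlev : ∀ e ∈ L, ∃ d : ℕ, level lab e.1 = d ∧ level lab e.2 = (d + 1 : ℕ) ∧
      0 < N.resCap f e.1 e.2 := by
    intro e he
    obtain ⟨d, h1, h2, -, h4⟩ := hlab.of_mem_pathEdges hd (hL ▸ he)
    exact ⟨d, h1, h2, h4⟩
  have hmono := level_mono hlab hlab' (L := L) (by
    intro e he
    obtain ⟨d, h1, h2, -⟩ := hlev e he
    rw [h1, h2]
    push_cast
    rfl) hres
  obtain ⟨⟨u, v⟩, he, h0⟩ := hcrit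
  obtain ⟨c, hu, hv, hr⟩ := hlev _ he
  simp only at h0 hu hv hr
  obtain ⟨q, hq⟩ := exists_of_level_eq hu
  have hc := hlab.level_lt_card hq
  have hnew : (u, v, ⟨c, hc⟩) ∉ H := fun hmem => by
    have := (hH _ hmem).2 hr
    simp [hu] at this
  refine ⟨insert (u, v, ⟨c, hc⟩) H, ?_, by rw [Finset.card_insert_of_notMem hnew]; omega⟩
  intro x hx
  rcases Finset.mem_insert.1 hx with rfl | hx
  · refine ⟨lt_of_lt_of_le ?_ (hmono v), fun h => absurd h0 h.ne'⟩
    simp only [hv]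
    exact_mod_cast c.lt_succ_self
  · obtain ⟨h1, h2⟩ := hH x hx
    refine ⟨h1.trans_le (hmono _), fun h => lt_of_lt_of_le ?_ (hmono _)⟩
    rcases hres _ _ h with h | h
    · exact h2 h
    · obtain ⟨b, hb1, hb2, -⟩ := hlev _ h
      simp only at hb1 hb2
      rw [hb1] at h1
      rw [hb2]
      exact h1.trans (by exact_mod_cast b.lt_succ_self)

theorem val_augmentLoop_succ_of_none {k : ℕ} (h : (bfsLabels N f).val N.sink = none) :
    (augmentLoop N (k + 1) f).val = f := by
  simp [augmentLoop, h]

theorem val_augmentLoop_succ_of_some {k d : ℕ} {p : V}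
    (h : (bfsLabels N f).val N.sink = some (d, p)) {L : List (V × V)}
    (hL : L = (pathEdges (bfsLabels N f).val d N.sink).val) :
    (augmentLoop N (k + 1) f).val = (augmentLoop N k
      (L.foldl (fun g e => pushEdge N (bottleneck N f L).toNNReal g e.1 e.2) f)).val := by
  simp [augmentLoop, h, val_loop, bottleneck, hL]

omit [DecidableEq V] in
theorem isFlow_zero (N : FlowNetwork V) : N.IsFlow fun _ _ => 0 :=
  ⟨by simp, by simp⟩

theorem augmentLoop_spec (hs : ∀ v, N.cap N.source v ≠ ⊤) (k : ℕ) (f : V → V → ℝ≥0)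
    (hf : N.IsFlow f) (H : Finset (V × V × Fin (Fintype.card V)))
    (hH : IsHistory N f (bfsLabels N f).val H) (hk : Fintype.card V ^ 3 ≤ H.card + k) :
    N.IsFlow (augmentLoop N k f).val ∧
      ¬ N.ResReachable (augmentLoop N k f).val N.source N.sink := by
  have hlab := isBfsLabelling_bfsLabels N f
  rcases hsink : (bfsLabels N f).val N.sink with _ | ⟨d, p⟩
  · have hval : (augmentLoop N k f).val = f := by
      cases k with
      | zero => rfl
      | succ k => exact val_augmentLoop_succ_of_none hsink
    rw [hval]
    exact ⟨hf, fun h => hlab.level_ne_top h (level_of_eq_none hsink)⟩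
  · obtain ⟨h1, -, h3, h4⟩ := hlab.augment hf hs hsink rfl rfl
    obtain ⟨H', hH', hcard⟩ := hH.augment hlab (isBfsLabelling_bfsLabels N _) hsink rfl h3 h4
    have hle : H'.card ≤ Fintype.card V ^ 3 := by
      refine H'.card_le_univ.trans (le_of_eq ?_)
      simp only [Fintype.card_prod, Fintype.card_fin]
      ring
    cases k with
    | zero => omega
    | succ k =>
      rw [val_augmentLoop_succ_of_some hsink rfl]
      exact augmentLoop_spec hs k _ h1 H' hH' (by omega)

/-- The Edmonds-Karp algorithm finds a flow without augmenting path. -/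
theorem edmondsKarp_spec (hs : ∀ v, N.cap N.source v ≠ ⊤) :
    N.IsFlow (edmondsKarp N).val ∧ ¬ N.ResReachable (edmondsKarp N).val N.source N.sink :=
  augmentLoop_spec hs _ _ (isFlow_zero N) ∅ (by simp [IsHistory]) (by simp)

theorem steps_augmentLoop_le (k : ℕ) (f : V → V → ℝ≥0) :
    (augmentLoop N k f).steps ≤ k * (9 * Fintype.card V ^ 3) := by
  induction k generalizing f with
  | zero => simp [augmentLoop]
  | succ k ih =>
    have hb := steps_bfsLabels_le N f
    have hpos : 1 ≤ Fintype.card V := Fintype.card_pos_iff.2 ⟨N.source⟩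
    have hc2 : Fintype.card V ≤ Fintype.card V ^ 3 := Nat.le_self_pow (by norm_num) _
    have hc3 : Fintype.card V ^ 2 ≤ Fintype.card V ^ 3 := Nat.pow_le_pow_right hpos (by norm_num)
    have hb' : (bfsLabels N f).steps ≤ 4 * Fintype.card V ^ 3 := by nlinarith
    rcases hsink : (bfsLabels N f).val N.sink with _ | ⟨d, p⟩
    · simp only [augmentLoop, steps_bind, steps_charge, hsink, steps_pure]
      nlinarith
    · have hd := (isBfsLabelling_bfsLabels N f).level_lt_card hsink
      simp only [augmentLoop, steps_bind, steps_charge, hsink]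
      have hlen := length_pathEdges_le (bfsLabels N f).val d N.sink
      have h1 := steps_pathEdges_le (bfsLabels N f).val d N.sink
      have h2 := steps_loop_le (c := 0) (pathEdges (bfsLabels N f).val d N.sink).val (⊤ : ℝ≥0∞)
        (body := fun δ e => pure (min δ (N.resCap f e.1 e.2))) (by simp)
      have h3 := fun δ : ℝ≥0 => steps_loop_le (c := 0)
        (pathEdges (bfsLabels N f).val d N.sink).val f
        (body := fun g e => pure (pushEdge N δ g e.1 e.2)) (by simp)
      specialize h3 (loop (pathEdges (bfsLabels N f).val d N.sink).val (⊤ : ℝ≥0∞)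
        (fun δ e => pure (min δ (N.resCap f e.1 e.2)))).val.toNNReal
      have h4 := ih (loop (pathEdges (bfsLabels N f).val d N.sink).val f (fun g e =>
        pure (pushEdge N (loop (pathEdges (bfsLabels N f).val d N.sink).val (⊤ : ℝ≥0∞)
        (fun δ e => pure (min δ (N.resCap f e.1 e.2)))).val.toNNReal g e.1 e.2))).val
      rw [add_mul]
      omega

theorem steps_edmondsKarp_le (N : FlowNetwork V) :
    (edmondsKarp N).steps ≤ 11 * Fintype.card V ^ 6 := by
  have hpos : 1 ≤ Fintype.card V := Fintype.card_pos_iff.2 ⟨N.source⟩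
  have h1 := steps_augmentLoop_le (N := N) (Fintype.card V ^ 3) fun _ _ => 0
  have h2 : Fintype.card V ^ 2 ≤ Fintype.card V ^ 6 := Nat.pow_le_pow_right hpos (by norm_num)
  have h3 : 1 ≤ Fintype.card V ^ 6 := Nat.one_le_pow _ _ hpos
  have h4 : Fintype.card V ^ 3 * (9 * Fintype.card V ^ 3) = 9 * Fintype.card V ^ 6 := by ring
  simp only [edmondsKarp, steps_bind, steps_charge]
  omega

end EdmondsKarp

/-! ### Cuts of the bipartite network -/

section Network

variable {n : ℕ} {m : MassFunction n} {α : ℝ} {f : Node m → Node m → ℝ≥0}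

/-- The vertices as an iterated disjoint sum. -/
def nodeEquiv (m : MassFunction n) :
    Node m ≃ (Fin n ⊕ {F : Finset (Fin n) // F ∈ m.focal}) ⊕ (Unit ⊕ Unit) where
  toFun
    | .s => .inr (.inl ())
    | .elem j => .inl (.inl j)
    | .focal F => .inl (.inr F)
    | .t => .inr (.inr ())
  invFun
    | .inr (.inl ()) => .s
    | .inl (.inl j) => .elem j
    | .inl (.inr F) => .focal F
    | .inr (.inr ()) => .t
  left_inv x := by cases x <;> rfl
  right_inv x := by rcases x with (_ | _) | (_ | _) <;> rfl

theorem card_node (m : MassFunction n) : Fintype.card (Node m) = n + m.focal.card + 2 := by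
  rw [Fintype.card_congr (nodeEquiv m)]
  simp

theorem sum_node {M : Type} [AddCommMonoid M] (g : Node m → M) :
    ∑ v, g v = ∑ j, g (.elem j) + ∑ F, g (.focal F) + (g .s + g .t) := by
  rw [← (nodeEquiv m).symm.sum_comp]
  simp [Fintype.sum_sum_type, nodeEquiv]

theorem eq_zero_of_cap_eq_zero {V : Type} [Fintype V] {N : FlowNetwork V} {g : V → V → ℝ≥0}
    (hg : N.IsFlow g) {u v : V} (h : N.cap u v = 0) : g u v = 0 := by
  have := hg.1 u v
  rw [h] at this
  exact_mod_cast nonpos_iff_eq_zero.1 this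

theorem source_cap_ne_top (m : MassFunction n) (α : ℝ) (v : Node m) :
    (network m α).cap (network m α).source v ≠ ⊤ := by
  cases v <;> simp [network, nodeCap]

theorem mass_pos (F : {F : Finset (Fin n) // F ∈ m.focal}) : 0 < m.mass F.1 := by
  have := F.2
  simpa [MassFunction.focal] using this

theorem pl_eq_sum_focal (m : MassFunction n) (B : Finset (Fin n)) :
    m.pl B = ∑ F : {F : Finset (Fin n) // F ∈ m.focal},
      if F.1 ∩ B ≠ ∅ then m.mass F.1 else 0 := by
  rw [Finset.univ_eq_attach, Finset.sum_attach m.focal (fun F => if F ∩ B ≠ ∅ then m.mass F else 0),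
    MassFunction.pl, Finset.sum_filter, MassFunction.focal, Finset.sum_filter]
  refine Finset.sum_congr rfl fun F _ => ?_
  have := m.mass_nonneg F
  grind

theorem flow_source_le (hα : 0 ≤ α) (hf : (network m α).IsFlow f) (j : Fin n) :
    (f .s (.elem j) : ℝ) ≤ α := by
  have := hf.1 .s (.elem j)
  simp only [network, nodeCap] at this
  rw [ENNReal.ofReal, ENNReal.coe_le_coe] at this
  simpa [Real.coe_toNNReal α hα] using NNReal.coe_le_coe.2 this

theorem flow_sink_le (hf : (network m α).IsFlow f) (F : {F : Finset (Fin n) // F ∈ m.focal}) :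
    (f (.focal F) .t : ℝ) ≤ m.mass F.1 := by
  have := hf.1 (.focal F) .t
  simp only [network, nodeCap] at this
  rw [ENNReal.ofReal, ENNReal.coe_le_coe] at this
  simpa [Real.coe_toNNReal _ (mass_pos F).le] using NNReal.coe_le_coe.2 this

theorem flow_middle_eq_zero (hf : (network m α).IsFlow f) {j : Fin n}
    {F : {F : Finset (Fin n) // F ∈ m.focal}} (h : j ∉ F.1) : f (.elem j) (.focal F) = 0 :=
  eq_zero_of_cap_eq_zero hf (by simp [network, nodeCap, h])

theorem conservation_elem (hf : (network m α).IsFlow f) (j : Fin n) :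
    (f .s (.elem j) : ℝ) = ∑ F, (f (.elem j) (.focal F) : ℝ) := by
  have h := hf.2 (.elem j) (by simp [network]) (by simp [network])
  have z : ∀ u v, (network m α).cap u v = 0 → f u v = 0 := fun u v => eq_zero_of_cap_eq_zero hf
  simp only [sum_node] at h
  simp [z (.elem _) (.elem _) rfl, z (.focal _) (.elem _) rfl, z .t (.elem _) rfl,
    z (.elem _) .s rfl, z (.elem _) .t rfl] at h
  exact_mod_cast h

theorem conservation_focal (hf : (network m α).IsFlow f)
    (F : {F : Finset (Fin n) // F ∈ m.focal}) :
    ∑ j, (f (.elem j) (.focal F) : ℝ) = f (.focal F) .t := by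
  have h := hf.2 (.focal F) (by simp [network]) (by simp [network])
  have z : ∀ u v, (network m α).cap u v = 0 → f u v = 0 := fun u v => eq_zero_of_cap_eq_zero hf
  simp only [sum_node] at h
  simp [z (.focal _) (.focal _) rfl, z .s (.focal _) rfl, z .t (.focal _) rfl,
    z (.focal _) .s rfl, z (.focal _) (.elem _) rfl] at h
  exact_mod_cast h

theorem value_eq (hf : (network m α).IsFlow f) :
    (network m α).value f = ∑ j, (f .s (.elem j) : ℝ) := by
  have z : ∀ u v, (network m α).cap u v = 0 → f u v = 0 := fun u v => eq_zero_of_cap_eq_zero hf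
  have hs : (network m α).source = .s := rfl
  simp only [FlowNetwork.value, hs, sum_node]
  simp [z .s (.focal _) rfl, z .s .s rfl, z .s .t rfl, z (.elem _) .s rfl, z (.focal _) .s rfl,
    z .t .s rfl]

/-- The gap between a flow and the cut that separates the elements of `B` and the focal sets which
they hit from the sink: unused capacity across the cut, and flow back across it. -/
theorem cut_sub_value (hf : (network m α).IsFlow f) (B : Finset (Fin n)) :
    m.pl B - α * (B.card : ℝ) + n * α - (network m α).value f =
      ∑ j, (if j ∈ B then 0 else α - (f .s (.elem j) : ℝ)) +
      ∑ F : {F : Finset (Fin n) // F ∈ m.focal}, (if F.1 ∩ B ≠ ∅ then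
        (m.mass F.1 - f (.focal F) .t) +
          ∑ j, (if j ∈ B then 0 else (f (.elem j) (.focal F) : ℝ)) else 0) := by
  have h1 : ∑ j : Fin n, (if j ∈ B then (0 : ℝ) else α) = n * α - α * B.card := by
    have : ∀ j : Fin n, (if j ∈ B then (0 : ℝ) else α) = α - if j ∈ B then α else 0 := by
      intro j
      split_ifs <;> simp
    simp only [this, Finset.sum_sub_distrib]
    simp
    ring
  have h2 : ∑ j, (if j ∈ B then (f .s (.elem j) : ℝ) else 0) =
      ∑ F : {F : Finset (Fin n) // F ∈ m.focal}, ∑ j,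
        (if j ∈ B then (f (.elem j) (.focal F) : ℝ) else 0) := by
    rw [Finset.sum_comm]
    refine Finset.sum_congr rfl fun j _ => ?_
    split_ifs
    · exact conservation_elem hf j
    · simp
  have h3 : ∀ F : {F : Finset (Fin n) // F ∈ m.focal},
      ∑ j, (if j ∈ B then (f (.elem j) (.focal F) : ℝ) else 0) =
        if F.1 ∩ B ≠ ∅ then
          f (.focal F) .t - ∑ j, (if j ∈ B then 0 else (f (.elem j) (.focal F) : ℝ)) else 0 := by
    intro F
    split_ifs with hF
    · rw [← conservation_focal hf F, ← Finset.sum_sub_distrib]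
      refine Finset.sum_congr rfl fun j _ => ?_
      split_ifs <;> simp
    · refine Finset.sum_eq_zero fun j _ => ?_
      split_ifs with hj
      · rw [flow_middle_eq_zero hf fun hjF => hF ?_]
        · simp
        · exact Finset.ne_empty_of_mem (Finset.mem_inter.2 ⟨hjF, hj⟩)
      · rfl
  have h4 : ∑ j, (if j ∈ B then 0 else α - (f .s (.elem j) : ℝ)) =
      ∑ j : Fin n, (if j ∈ B then (0 : ℝ) else α) - ∑ j, (f .s (.elem j) : ℝ) +
        ∑ j, (if j ∈ B then (f .s (.elem j) : ℝ) else 0) := by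
    rw [← Finset.sum_sub_distrib, ← Finset.sum_add_distrib]
    refine Finset.sum_congr rfl fun j _ => ?_
    split_ifs <;> ring
  have h5 : ∑ F : {F : Finset (Fin n) // F ∈ m.focal}, (if F.1 ∩ B ≠ ∅ then
        (m.mass F.1 - f (.focal F) .t) +
          ∑ j, (if j ∈ B then 0 else (f (.elem j) (.focal F) : ℝ)) else 0) =
      m.pl B - ∑ F : {F : Finset (Fin n) // F ∈ m.focal}, ∑ j,
        (if j ∈ B then (f (.elem j) (.focal F) : ℝ) else 0) := by
    rw [pl_eq_sum_focal, ← Finset.sum_sub_distrib]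
    refine Finset.sum_congr rfl fun F _ => ?_
    rw [h3]
    split_ifs <;> ring
  rw [h4, h5, h1, h2, value_eq hf]
  ring

theorem focal_gap_nonneg (hf : (network m α).IsFlow f) (B : Finset (Fin n))
    (F : {F : Finset (Fin n) // F ∈ m.focal}) :
    0 ≤ (m.mass F.1 - f (.focal F) .t : ℝ) +
      ∑ j, (if j ∈ B then 0 else (f (.elem j) (.focal F) : ℝ)) :=
  add_nonneg (sub_nonneg.2 (flow_sink_le hf F))
    (Finset.sum_nonneg fun j _ => by split_ifs <;> simp)

/-- Weak duality. -/
theorem value_le_cut (hα : 0 ≤ α) (hf : (network m α).IsFlow f) (B : Finset (Fin n)) :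
    (network m α).value f ≤ m.pl B - α * (B.card : ℝ) + n * α := by
  rw [← sub_nonneg, cut_sub_value hf B]
  refine add_nonneg (Finset.sum_nonneg fun j _ => ?_) (Finset.sum_nonneg fun F _ => ?_)
  · split_ifs
    · exact le_rfl
    · exact sub_nonneg.2 (flow_source_le hα hf j)
  · split_ifs
    · exact focal_gap_nonneg hf B F
    · exact le_rfl

/-- A tight cut is saturated, and no flow goes back across it. -/
theorem saturated_of_value_eq_cut (hα : 0 ≤ α) (hf : (network m α).IsFlow f) {B : Finset (Fin n)}
    (h : (network m α).value f = m.pl B - α * (B.card : ℝ) + n * α) :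
    (∀ j ∉ B, (f .s (.elem j) : ℝ) = α) ∧
      ∀ F : {F : Finset (Fin n) // F ∈ m.focal}, F.1 ∩ B ≠ ∅ →
        (f (.focal F) .t : ℝ) = m.mass F.1 ∧ ∀ j ∉ B, f (.elem j) (.focal F) = 0 := by
  have hcut := cut_sub_value hf B
  rw [h, sub_self, eq_comm] at hcut
  have n1 : ∀ j ∈ Finset.univ, 0 ≤ (if j ∈ B then 0 else α - (f .s (.elem j) : ℝ)) := by
    intro j _
    split_ifs
    · exact le_rfl
    · exact sub_nonneg.2 (flow_source_le hα hf j)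
  have n2 : ∀ F ∈ (Finset.univ : Finset {F : Finset (Fin n) // F ∈ m.focal}),
      0 ≤ (if F.1 ∩ B ≠ ∅ then (m.mass F.1 - f (.focal F) .t) +
          ∑ j, (if j ∈ B then 0 else (f (.elem j) (.focal F) : ℝ)) else 0) := by
    intro F _
    split_ifs
    · exact focal_gap_nonneg hf B F
    · exact le_rfl
  obtain ⟨e1, e2⟩ :=
    (add_eq_zero_iff_of_nonneg (Finset.sum_nonneg n1) (Finset.sum_nonneg n2)).1 hcut
  rw [Finset.sum_eq_zero_iff_of_nonneg n1] at e1
  rw [Finset.sum_eq_zero_iff_of_nonneg n2] at e2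
  refine ⟨fun j hj => ?_, fun F hF => ?_⟩
  · have := e1 j (Finset.mem_univ _)
    rw [if_neg hj] at this
    linarith
  · have h0 := e2 F (Finset.mem_univ _)
    have n3 : ∀ j ∈ Finset.univ, 0 ≤ (if j ∈ B then 0 else (f (.elem j) (.focal F) : ℝ)) :=
      fun j _ => by split_ifs <;> simp
    rw [if_pos hF, add_eq_zero_iff_of_nonneg (sub_nonneg.2 (flow_sink_le hf F))
      (Finset.sum_nonneg n3), Finset.sum_eq_zero_iff_of_nonneg n3] at h0
    refine ⟨by linarith [h0.1], fun j hj => ?_⟩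
    have := h0.2 j (Finset.mem_univ _)
    rw [if_neg hj] at this
    exact_mod_cast this

/-! ### Minimization by maximum flows -/

theorem mem_nonReaching {j : Fin n} :
    j ∈ nonReaching m α f ↔ ¬ (network m α).ResReachable f (.elem j) .t := by
  simp [nonReaching]

theorem resCap_source_pos {j : Fin n} (h : (f .s (.elem j) : ℝ) < α) :
    0 < (network m α).resCap f .s (.elem j) := by
  have hα : 0 < α := lt_of_le_of_lt (f .s (.elem j)).2 h
  have hc : (network m α).cap .s (.elem j) = ENNReal.ofReal α := rfl
  simp only [FlowNetwork.resCap, hc, ne_eq, ENNReal.ofReal_eq_zero, hα.not_ge, not_false_eq_true,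
    if_true, tsub_pos_iff_lt]
  rw [ENNReal.ofReal, ENNReal.coe_lt_coe, ← NNReal.coe_lt_coe, Real.coe_toNNReal _ hα.le]
  exact h

theorem resCap_sink_pos {F : {F : Finset (Fin n) // F ∈ m.focal}}
    (h : (f (.focal F) .t : ℝ) < m.mass F.1) : 0 < (network m α).resCap f (.focal F) .t := by
  have hc : (network m α).cap (.focal F) .t = ENNReal.ofReal (m.mass F.1) := rfl
  simp only [FlowNetwork.resCap, hc, ne_eq, ENNReal.ofReal_eq_zero, (mass_pos F).not_ge,
    not_false_eq_true, if_true, tsub_pos_iff_lt]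
  rw [ENNReal.ofReal, ENNReal.coe_lt_coe, ← NNReal.coe_lt_coe, Real.coe_toNNReal _ (mass_pos F).le]
  exact h

theorem resCap_middle_pos {j : Fin n} {F : {F : Finset (Fin n) // F ∈ m.focal}} (h : j ∈ F.1) :
    0 < (network m α).resCap f (.elem j) (.focal F) := by
  simp [FlowNetwork.resCap, network, nodeCap, h]

/-- If no augmenting path exists, the cut given by `nonReaching` is tight. -/
theorem value_eq_cut_nonReaching (hα : 0 ≤ α) (hf : (network m α).IsFlow f)
    (h : ¬ (network m α).ResReachable f .s .t) :
    (network m α).value f =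
      m.pl (nonReaching m α f) - α * ((nonReaching m α f).card : ℝ) + n * α := by
  rw [eq_comm, ← sub_eq_zero, cut_sub_value hf]
  have h1 : ∀ j : Fin n, (if j ∈ nonReaching m α f then 0 else α - (f .s (.elem j) : ℝ)) = 0 := by
    intro j
    split_ifs with hj
    · rfl
    · rw [mem_nonReaching, not_not] at hj
      by_contra hne
      refine h (.head (resCap_source_pos ?_) hj)
      exact lt_of_le_of_ne (flow_source_le hα hf j) fun h0 => hne (by rw [h0, sub_self])
  have h2 : ∀ F : {F : Finset (Fin n) // F ∈ m.focal}, (if F.1 ∩ nonReaching m α f ≠ ∅ then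
        (m.mass F.1 - f (.focal F) .t) +
          ∑ j, (if j ∈ nonReaching m α f then 0 else (f (.elem j) (.focal F) : ℝ)) else 0) = 0 := by
    intro F
    split_ifs with hF
    · obtain ⟨i, hi⟩ := Finset.nonempty_iff_ne_empty.2 hF
      rw [Finset.mem_inter, mem_nonReaching] at hi
      have hFt : ¬ (network m α).ResReachable f (.focal F) .t :=
        fun hr => hi.2 (.head (resCap_middle_pos hi.1) hr)
      have e1 : (f (.focal F) .t : ℝ) = m.mass F.1 :=
        le_antisymm (flow_sink_le hf F)
          (not_lt.1 fun hlt => hFt (.single (resCap_sink_pos hlt)))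
      rw [e1, sub_self, zero_add]
      refine Finset.sum_eq_zero fun j _ => ?_
      split_ifs with hj
      · rfl
      · rw [mem_nonReaching, not_not] at hj
        by_contra hne
        refine hFt (.head ?_ hj)
        have hc : (network m α).cap (.focal F) (.elem j) = 0 := rfl
        simp only [FlowNetwork.resCap, hc]
        simpa [pos_iff_ne_zero] using hne
    · rfl
  simp only [h1, h2, Finset.sum_const_zero, add_zero]

theorem isMaxFlow_of_not_resReachable (hα : 0 ≤ α) (hf : (network m α).IsFlow f)
    (h : ¬ (network m α).ResReachable f .s .t) : (network m α).IsMaxFlow f :=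
  ⟨hf, fun g hg => by
    rw [value_eq_cut_nonReaching hα hf h]
    exact value_le_cut hα hg _⟩

/-- No residual edge leaves the source side of a tight cut. -/
theorem subset_nonReaching_of_value_eq_cut (hα : 0 ≤ α) (hf : (network m α).IsFlow f)
    {B : Finset (Fin n)}
    (h : (network m α).value f = m.pl B - α * (B.card : ℝ) + n * α) :
    B ⊆ nonReaching m α f := by
  obtain ⟨h1, h2⟩ := saturated_of_value_eq_cut hα hf h
  let X : Node m → Prop
    | .s => True
    | .elem j => j ∈ B
    | .focal F => F.1 ∩ B ≠ ∅
    | .t => False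
  have z : ∀ u v, (network m α).cap u v = 0 → f u v = 0 := fun u v => eq_zero_of_cap_eq_zero hf
  have zr : ∀ u v, (network m α).cap u v = 0 → f v u = 0 → ¬ 0 < (network m α).resCap f u v := by
    intro u v hc h0
    simp [FlowNetwork.resCap, hc, h0]
  have hX : ∀ u v, X u → 0 < (network m α).resCap f u v → X v := by
    intro u v hu hr
    cases u with
    | s =>
      cases v with
      | s => trivial
      | elem j =>
        by_contra hj
        have hc : (network m α).cap .s (.elem j) = ENNReal.ofReal α := rfl
        have hz : f (.elem j) .s = 0 := z _ _ rfl
        simp only [FlowNetwork.resCap, hc, hz] at hr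
        simp [← h1 j hj] at hr
      | focal F => exact absurd hr (zr _ _ rfl (z _ _ rfl))
      | t => exact absurd hr (zr _ _ rfl (z _ _ rfl))
    | elem j =>
      cases v with
      | s => trivial
      | elem i => exact absurd hr (zr _ _ rfl (z _ _ rfl))
      | focal F =>
        by_cases hj : j ∈ F.1
        · exact Finset.ne_empty_of_mem (Finset.mem_inter.2 ⟨hj, hu⟩)
        · exact absurd hr (zr _ _ (by simp [network, nodeCap, hj]) (z _ _ rfl))
      | t => exact absurd hr (zr _ _ rfl (z _ _ rfl))
    | focal F =>
      cases v with
      | s => trivial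
      | elem j =>
        by_contra hj
        exact zr _ _ rfl ((h2 F hu).2 j hj) hr
      | focal F' => exact absurd hr (zr _ _ rfl (z _ _ rfl))
      | t =>
        have hc : (network m α).cap (.focal F) .t = ENNReal.ofReal (m.mass F.1) := rfl
        have hz : f .t (.focal F) = 0 := z _ _ rfl
        simp only [FlowNetwork.resCap, hc, hz, ← (h2 F hu).1] at hr
        simp at hr
    | t => exact hu.elim
  intro j hj
  rw [mem_nonReaching]
  intro hr
  have : ∀ v, (network m α).ResReachable f (.elem j) v → X v := by
    intro v hv
    induction hv with
    | refl => exact hj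
    | tail _ hab ih => exact hX _ _ ih hab
  exact this _ hr

theorem isMaximalMinimizer_nonReaching (hα : 0 ≤ α) (hf : (network m α).IsMaxFlow f) :
    IsMaximalMinimizer (fun A => m.pl A - α * (A.card : ℝ)) (nonReaching m α f) ∧
      (network m α).value f =
        m.pl (nonReaching m α f) - α * ((nonReaching m α f).card : ℝ) + n * α := by
  have hval := value_eq_cut_nonReaching hα hf.1
    (not_resReachable_of_isMaxFlow (source_cap_ne_top m α) hf)
  refine ⟨⟨fun B => ?_, fun B hB => ?_⟩, hval⟩
  · have := value_le_cut hα hf.1 B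
    simp only
    linarith
  · refine subset_nonReaching_of_value_eq_cut hα hf.1 ?_
    have h1 := value_le_cut hα hf.1 B
    have h2 := hB (nonReaching m α f)
    simp only at h2
    linarith

theorem isMaxFlow_edmondsKarpSolver (m : MassFunction n) (hα : 0 ≤ α) :
    (network m α).IsMaxFlow (edmondsKarpSolver m α).1 := by
  obtain ⟨h1, h2⟩ := edmondsKarp_spec (N := network m α) (source_cap_ne_top m α)
  exact isMaxFlow_of_not_resReachable hα h1 h2

theorem val_minimizerProg (mf : FlowSolver m) (α : ℝ) :
    (minimizerProg mf α).val = nonReaching m α (mf α).1 := by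
  have key : ∀ (seen : Finset (Node m)),
      ((List.finRange n).foldl
        (fun A j => if Node.elem j ∈ seen then A else insert j A) ∅) =
        Finset.univ.filter fun j => Node.elem j ∉ seen := by
    intro seen
    have := foldl_invariant (g := fun (A : Finset (Fin n)) j =>
        if Node.elem j ∈ seen then A else insert j A)
      (fun done A => ∀ j, j ∈ A ↔ j ∈ done ∧ Node.elem j ∉ seen) (by
        intro done A i hA j
        split_ifs with hi
        · simp only [hA, List.mem_append, List.mem_singleton]
          grind
        · simp only [Finset.mem_insert, hA, List.mem_append, List.mem_singleton]
          grind) (List.finRange n) [] ∅ (by simp)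
    ext j
    simp [this]
  ext j
  simp only [minimizerProg, val_bind, val_loop, val_pure, key, Finset.mem_filter,
    Finset.mem_univ, true_and, mem_depthFirstSearch, mem_nonReaching, decide_eq_true_eq,
    FlowNetwork.ResReachable, maxFlowProg]
  rw [← Relation.reflTransGen_swap]

theorem flows_minimizerProg (mf : FlowSolver m) (α : ℝ) : (minimizerProg mf α).flows = 1 := by
  simp only [minimizerProg, flows_bind, flows_depthFirstSearch, maxFlowProg]
  rw [flows_loop _ _ fun _ _ => rfl]

theorem searches_minimizerProg (mf : FlowSolver m) (α : ℝ) :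
    (minimizerProg mf α).searches = 1 := by
  simp only [minimizerProg, searches_bind, searches_depthFirstSearch, maxFlowProg]
  rw [searches_loop _ _ fun _ _ => rfl]

theorem steps_minimizerProg_le (mf : FlowSolver m) (α : ℝ) :
    (minimizerProg mf α).steps ≤
      (mf α).2 + (n + m.focal.card + 2) * (n + m.focal.card + 3) + n := by
  simp only [minimizerProg, steps_bind, maxFlowProg]
  have h1 : (depthFirstSearch (fun u v => decide (0 < (network m α).resCap (mf α).1 v u))
      Node.t).steps ≤ (n + m.focal.card + 2) * (n + m.focal.card + 3) := by
    refine (steps_depthFirstSearch_le _).trans ?_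
    rw [card_node]
  have h2 := steps_loop_le (c := 0) (List.finRange n) (∅ : Finset (Fin n)) (body := fun A j =>
    (pure (if Node.elem j ∈ (depthFirstSearch (fun u v =>
      decide (0 < (network m α).resCap (mf α).1 v u)) Node.t).val then A else insert j A) :
      Counted (Finset (Fin n)))) (by simp)
  simp only [List.length_finRange] at h2
  omega

end Network

/-! ### Plausibility and its penalized minimizers -/

section Plausibility

variable {n : ℕ} (m : MassFunction n)

theorem pl_eq_sum_ite (B : Finset (Fin n)) :
    m.pl B = ∑ A, if A ∩ B ≠ ∅ then m.mass A else 0 := by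
  rw [MassFunction.pl, Finset.sum_filter]

@[simp] theorem pl_empty : m.pl ∅ = 0 := by simp [pl_eq_sum_ite]

theorem pl_univ : m.pl Finset.univ = 1 := by
  rw [pl_eq_sum_ite, ← m.mass_sum]
  refine Finset.sum_congr rfl fun A _ => ?_
  by_cases h : A = ∅
  · simp [h, m.mass_empty]
  · simp [h]

theorem bel_eq (B : Finset (Fin n)) : m.bel B = 1 - m.pl Bᶜ := by
  rw [pl_eq_sum_ite, MassFunction.bel, Finset.sum_filter, ← m.mass_sum, ← Finset.sum_sub_distrib]
  refine Finset.sum_congr rfl fun A _ => ?_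
  have : A ∩ Bᶜ = ∅ ↔ A ⊆ B := by
    rw [← Finset.disjoint_iff_inter_eq_empty, disjoint_compl_right_iff]
  by_cases h : A ⊆ B
  · simp [h, this]
  · simp [h, this]

theorem pl_mono {A B : Finset (Fin n)} (h : A ⊆ B) : m.pl A ≤ m.pl B := by
  rw [pl_eq_sum_ite, pl_eq_sum_ite]
  refine Finset.sum_le_sum fun F _ => ?_
  have := m.mass_nonneg F
  split_ifs with h1 h2
  · exact le_rfl
  · exact absurd (Finset.subset_empty.1 ((Finset.inter_subset_inter_left h).trans
      (not_not.1 h2).subset)) h1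
  · exact this
  · exact le_rfl

/-- Plausibility functions are submodular. -/
theorem pl_union_add_pl_inter_le (A B : Finset (Fin n)) :
    m.pl (A ∪ B) + m.pl (A ∩ B) ≤ m.pl A + m.pl B := by
  simp only [pl_eq_sum_ite, ← Finset.sum_add_distrib]
  refine Finset.sum_le_sum fun F _ => ?_
  have h0 := m.mass_nonneg F
  have h1 : F ∩ (A ∪ B) ≠ ∅ ↔ F ∩ A ≠ ∅ ∨ F ∩ B ≠ ∅ := by
    rw [Finset.inter_union_distrib_left, ne_eq, Finset.union_eq_empty]
    tauto
  have h2 : F ∩ (A ∩ B) ≠ ∅ → F ∩ A ≠ ∅ ∧ F ∩ B ≠ ∅ := by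
    simp only [← Finset.nonempty_iff_ne_empty]
    rintro ⟨x, hx⟩
    simp only [Finset.mem_inter] at hx
    exact ⟨⟨x, by simp [hx]⟩, ⟨x, by simp [hx]⟩⟩
  by_cases ha : F ∩ A = ∅ <;> by_cases hb : F ∩ B = ∅ <;> by_cases hc : F ∩ (A ∩ B) = ∅ <;>
    simp_all

/-- `A` minimizes `Pl(A) - α |A|`. -/
def IsPenalizedMinimizer (α : ℝ) (A : Finset (Fin n)) : Prop :=
  ∀ B, m.pl A - α * (A.card : ℝ) ≤ m.pl B - α * (B.card : ℝ)

variable {m}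

/-- The minimizers grow with the slope. -/
theorem IsPenalizedMinimizer.subset {α β : ℝ} (hβα : β ≤ α) {A B : Finset (Fin n)}
    (hA : IsPenalizedMinimizer m β A)
    (hB : IsMaximalMinimizer (fun A => m.pl A - α * (A.card : ℝ)) B) : A ⊆ B := by
  have h1 := pl_union_add_pl_inter_le m A B
  have h2 := hA (A ∩ B)
  have h3 : ((A ∪ B).card : ℝ) + ((A ∩ B).card : ℝ) = A.card + B.card := by
    exact_mod_cast Finset.card_union_add_card_inter A B
  have h4 : ((A ∩ B).card : ℝ) ≤ A.card := by
    exact_mod_cast Finset.card_le_card Finset.inter_subset_left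
  refine Finset.subset_union_left.trans (hB.2 (A ∪ B) fun D => ?_)
  have h5 := hB.1 D
  simp only at h5 ⊢
  have h6 : β * ((A.card : ℝ) - (A ∩ B).card) ≤ α * ((A.card : ℝ) - (A ∩ B).card) :=
    mul_le_mul_of_nonneg_right hβα (sub_nonneg.2 h4)
  have h7 : α * ((A ∪ B).card : ℝ) + α * ((A ∩ B).card : ℝ) = α * A.card + α * B.card := by
    rw [← mul_add, h3, mul_add]
  linarith

variable (m) in
/-- The slope of `Pl` between two sets. -/
noncomputable def slope (S S' : Finset (Fin n)) : ℝ := (m.pl S' - m.pl S) / ((S' \ S).card : ℝ)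

theorem slope_mul_card_sdiff {S S' : Finset (Fin n)} (h : S ⊂ S') :
    slope m S S' * ((S' \ S).card : ℝ) = m.pl S' - m.pl S := by
  have : 0 < (S' \ S).card := Finset.card_pos.2 (Finset.sdiff_nonempty.2 h.2)
  rw [slope, div_mul_cancel₀]
  exact_mod_cast this.ne'

theorem slope_mul_card_sub {S S' : Finset (Fin n)} (h : S ⊂ S') :
    slope m S S' * ((S'.card : ℝ) - S.card) = m.pl S' - m.pl S := by
  rw [← slope_mul_card_sdiff h, Finset.cast_card_sdiff h.1]

theorem slope_nonneg {S S' : Finset (Fin n)} (h : S ⊂ S') : 0 ≤ slope m S S' :=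
  div_nonneg (sub_nonneg.2 (pl_mono m h.1)) (Nat.cast_nonneg _)

theorem card_sub_pos {S S' : Finset (Fin n)} (h : S ⊂ S') : (0 : ℝ) < (S'.card : ℝ) - S.card := by
  have := Finset.card_lt_card h
  rw [sub_pos]
  exact_mod_cast this

theorem IsPenalizedMinimizer.le_slope {β : ℝ} {S S' : Finset (Fin n)} (h : S ⊂ S')
    (hS : IsPenalizedMinimizer m β S) : β ≤ slope m S S' := by
  have h1 := slope_mul_card_sub (m := m) h
  have h2 := hS S'
  refine le_of_mul_le_mul_right ?_ (card_sub_pos h)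
  linarith

theorem IsPenalizedMinimizer.slope_le {β : ℝ} {S S' : Finset (Fin n)} (h : S ⊂ S')
    (hS : IsPenalizedMinimizer m β S') : slope m S S' ≤ β := by
  have h1 := slope_mul_card_sub (m := m) h
  have h2 := hS S
  refine le_of_mul_le_mul_right ?_ (card_sub_pos h)
  linarith

/-- Both ends have the same penalized value for the slope between them. -/
theorem isPenalizedMinimizer_slope_iff {S S' : Finset (Fin n)} (h : S ⊂ S') :
    IsPenalizedMinimizer m (slope m S S') S ↔ IsPenalizedMinimizer m (slope m S S') S' := by
  have h1 := slope_mul_card_sub (m := m) h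
  refine forall_congr' fun B => ?_
  have : m.pl S - slope m S S' * S.card = m.pl S' - slope m S S' * S'.card := by linarith
  rw [this]

theorem isPenalizedMinimizer_empty : IsPenalizedMinimizer m 0 ∅ := by
  intro B
  simpa using pl_mono m (Finset.empty_subset B)

theorem isMaximalMinimizer_univ :
    IsMaximalMinimizer (fun A => m.pl A - 1 * (A.card : ℝ)) Finset.univ := by
  refine ⟨fun B => ?_, fun B _ => Finset.subset_univ B⟩
  simp only [pl_univ, Finset.card_univ, Fintype.card_fin, one_mul]
  by_cases hB : B = Finset.univ
  · simp [hB, pl_univ]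
  · have h1 : B.card < n := by
      simpa using Finset.card_lt_card (Finset.ssubset_univ_iff.2 hB)
    have h2 : (B.card : ℝ) + 1 ≤ n := by exact_mod_cast h1
    have h3 := pl_mono m (Finset.empty_subset B)
    rw [pl_empty] at h3
    linarith

/-- The maximal minimizer for the slope between two minimizers lies between them, and unless it is
the upper one it lies strictly between them. -/
theorem minimizer_between {S S' A : Finset (Fin n)} (h : S ⊂ S') {β β' : ℝ}
    (hS : IsPenalizedMinimizer m β S)
    (hS' : IsMaximalMinimizer (fun A => m.pl A - β' * (A.card : ℝ)) S')
    (hA : IsMaximalMinimizer (fun B => m.pl B - slope m S S' * (B.card : ℝ)) A) (hne : A ≠ S') :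
    S ⊂ A ∧ A ⊂ S' := by
  have h1 : S ⊆ A := hS.subset (hS.le_slope h) hA
  have h2 : A ⊆ S' :=
    IsPenalizedMinimizer.subset (IsPenalizedMinimizer.slope_le h hS'.1) hA.1 hS'
  refine ⟨h1.ssubset_of_ne fun hSA => ?_, h2.ssubset_of_ne hne⟩
  subst hSA
  exact h.2 (hA.2 S' ((isPenalizedMinimizer_slope_iff h).1 hA.1))

/-! ### The vector of a principal chain -/

variable (m) in
/-- The list of the pairs of consecutive sets of a chain from `S` to `S'` in which the lower member
of each pair (equivalently the upper one, see `isPenalizedMinimizer_slope_iff`) is a minimizer for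
the slope between the two. -/
def IsPrincipalChain :
    Finset (Fin n) → List (Finset (Fin n) × Finset (Fin n)) → Finset (Fin n) → Prop
  | S, [], S' => S = S'
  | S, e :: l, S' => e.1 = S ∧ S ⊂ e.2 ∧ IsPenalizedMinimizer m (slope m S e.2) S ∧
      IsPrincipalChain e.2 l S'

theorem IsPrincipalChain.append {S A S' : Finset (Fin n)}
    {l l' : List (Finset (Fin n) × Finset (Fin n))} (h : IsPrincipalChain m S l A)
    (h' : IsPrincipalChain m A l' S') : IsPrincipalChain m S (l ++ l') S' := by
  induction l generalizing S with
  | nil =>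
    obtain rfl : S = A := h
    exact h'
  | cons e l ih => exact ⟨h.1, h.2.1, h.2.2.1, ih h.2.2.2⟩

theorem IsPrincipalChain.subset {S S' : Finset (Fin n)}
    {l : List (Finset (Fin n) × Finset (Fin n))} (h : IsPrincipalChain m S l S') : S ⊆ S' := by
  induction l generalizing S with
  | nil => exact (show S = S' from h).subset
  | cons e l ih => exact h.2.1.1.trans (ih h.2.2.2)

theorem IsPrincipalChain.length_add_card_le {S S' : Finset (Fin n)}
    {l : List (Finset (Fin n) × Finset (Fin n))} (h : IsPrincipalChain m S l S') :
    l.length + S.card ≤ S'.card := by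
  induction l generalizing S with
  | nil =>
    obtain rfl : S = S' := h
    simp
  | cons e l ih =>
    have h1 := ih h.2.2.2
    have h2 := Finset.card_lt_card h.2.1
    simp only [List.length_cons]
    omega

variable (m) in
/-- `p` is constant, equal to the slope, on the difference of every pair of the list. -/
def IsBlockVector (p : Fin n → ℝ) (l : List (Finset (Fin n) × Finset (Fin n))) : Prop :=
  ∀ e ∈ l, ∀ i ∈ e.2 \ e.1, p i = slope m e.1 e.2

theorem IsPrincipalChain.nonneg {S S' : Finset (Fin n)}
    {l : List (Finset (Fin n) × Finset (Fin n))} (h : IsPrincipalChain m S l S') {p : Fin n → ℝ}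
    (hp : IsBlockVector m p l) {i : Fin n} (hi : i ∈ S' \ S) : 0 ≤ p i := by
  induction l generalizing S with
  | nil =>
    obtain rfl : S = S' := h
    simp at hi
  | cons e l ih =>
    obtain ⟨rfl, h1, -, h3⟩ := h
    by_cases he : i ∈ e.2
    · rw [hp e (by simp) i (Finset.mem_sdiff.2 ⟨he, (Finset.mem_sdiff.1 hi).2⟩)]
      exact slope_nonneg h1
    · exact ih h3 (fun e he => hp e (List.mem_cons_of_mem _ he))
        (Finset.mem_sdiff.2 ⟨(Finset.mem_sdiff.1 hi).1, he⟩)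

theorem sum_sdiff_add_sum_sdiff {A B C : Finset (Fin n)} (h1 : A ⊆ B) (h2 : B ⊆ C) (g : Fin n → ℝ) :
    ∑ i ∈ C \ A, g i = ∑ i ∈ B \ A, g i + ∑ i ∈ C \ B, g i := by
  have e1 := Finset.sum_sdiff (f := g) h1
  have e2 := Finset.sum_sdiff (f := g) h2
  have e3 := Finset.sum_sdiff (f := g) (h1.trans h2)
  linarith

theorem sum_block {p : Fin n → ℝ} {e : Finset (Fin n) × Finset (Fin n)} (he : e.1 ⊂ e.2)
    (hp : ∀ i ∈ e.2 \ e.1, p i = slope m e.1 e.2) :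
    ∑ i ∈ e.2 \ e.1, p i = m.pl e.2 - m.pl e.1 := by
  rw [Finset.sum_congr rfl hp, Finset.sum_const, nsmul_eq_mul, mul_comm, slope_mul_card_sdiff he]

theorem IsPrincipalChain.sum_eq {S S' : Finset (Fin n)}
    {l : List (Finset (Fin n) × Finset (Fin n))} (h : IsPrincipalChain m S l S') {p : Fin n → ℝ}
    (hp : IsBlockVector m p l) : ∑ i ∈ S' \ S, p i = m.pl S' - m.pl S := by
  induction l generalizing S with
  | nil =>
    obtain rfl : S = S' := h
    simp
  | cons e l ih =>
    obtain ⟨rfl, h1, -, h3⟩ := h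
    rw [sum_sdiff_add_sum_sdiff h1.1 h3.subset, ih h3 fun e he => hp e (List.mem_cons_of_mem _ he),
      sum_block h1 (hp e (by simp))]
    ring

/-- The vector of a principal chain is dominated by `Pl`: on one block because the lower set is a
minimizer for the slope, and in general by submodularity. -/
theorem IsPrincipalChain.sum_inter_le {S S' : Finset (Fin n)}
    {l : List (Finset (Fin n) × Finset (Fin n))} (h : IsPrincipalChain m S l S') {p : Fin n → ℝ}
    (hp : IsBlockVector m p l) (A : Finset (Fin n)) :
    ∑ i ∈ S' \ S, (if i ∈ A then p i else 0) ≤ m.pl (A ∩ S') - m.pl (A ∩ S) := by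
  induction l generalizing S with
  | nil =>
    obtain rfl : S = S' := h
    simp
  | cons e l ih =>
    obtain ⟨rfl, h1, h2, h3⟩ := h
    have hrest := ih h3 fun e he => hp e (List.mem_cons_of_mem _ he)
    rw [sum_sdiff_add_sum_sdiff h1.1 h3.subset]
    have hblock : ∑ i ∈ e.2 \ e.1, (if i ∈ A then p i else 0) =
        slope m e.1 e.2 * (((e.2 \ e.1) ∩ A).card : ℝ) := by
      rw [Finset.sum_ite_mem, Finset.sum_congr rfl fun i hi =>
        hp e (by simp) i (Finset.mem_inter.1 hi).1, Finset.sum_const, nsmul_eq_mul, mul_comm]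
    have hmin := h2 (A ∩ e.2 ∪ e.1)
    have hcard : ((A ∩ e.2 ∪ e.1).card : ℝ) = ((e.2 \ e.1) ∩ A).card + e.1.card := by
      rw [← Nat.cast_add, ← Finset.card_union_of_disjoint]
      · congr 2
        ext i
        simp only [Finset.mem_union, Finset.mem_inter, Finset.mem_sdiff]
        tauto
      · exact Finset.disjoint_left.2 fun i hi =>
          (Finset.mem_sdiff.1 (Finset.mem_inter.1 hi).1).2
    have hsub := pl_union_add_pl_inter_le m (A ∩ e.2) e.1
    rw [Finset.inter_assoc, Finset.inter_eq_right.2 h1.1] at hsub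
    rw [hcard] at hmin
    rw [hblock]
    linarith

theorem sum_le_pl_of_mem_credalSet {q : Fin n → ℝ} (hq : q ∈ credalSet m.bel)
    (A : Finset (Fin n)) : ∑ i ∈ A, q i ≤ m.pl A := by
  have h1 := hq.2 Aᶜ
  rw [bel_eq, compl_compl] at h1
  have h2 := Finset.sum_add_sum_compl A q
  rw [hq.1.2] at h2
  linarith

theorem IsPrincipalChain.mem_credalSet {l : List (Finset (Fin n) × Finset (Fin n))}
    (h : IsPrincipalChain m ∅ l Finset.univ) {p : Fin n → ℝ} (hp : IsBlockVector m p l) :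
    p ∈ credalSet m.bel := by
  have hsum : ∑ i, p i = 1 := by simpa [pl_univ] using h.sum_eq hp
  refine ⟨⟨fun i => h.nonneg hp (by simp), hsum⟩, fun A => ?_⟩
  have h1 := h.sum_inter_le hp Aᶜ
  simp only [Finset.sdiff_empty, Finset.sum_ite_mem, Finset.univ_inter, Finset.inter_univ,
    Finset.inter_empty, pl_empty, sub_zero] at h1
  have h2 := Finset.sum_add_sum_compl A p
  rw [bel_eq]
  linarith

/-! ### Maximality of the entropy -/

theorem mul_log_tangent {x a : ℝ} (hx : 0 ≤ x) (ha : 0 < a) :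
    (x - a) * Real.log a ≤ x * Real.log x - a * Real.log a - x + a := by
  rcases hx.eq_or_lt with rfl | hx
  · simp [ha.le]
  · have h1 := Real.log_le_sub_one_of_pos (div_pos ha hx)
    rw [Real.log_div ha.ne' hx.ne'] at h1
    have h2 := mul_le_mul_of_nonneg_left h1 hx.le
    have h3 : x * (a / x - 1) = a - x := by
      field_simp
    nlinarith

/-- Abel summation along the chain: the slopes increase, and the slack `Pl - q` is nonnegative and
vanishes on the whole space. -/
theorem IsPrincipalChain.entropy_bound {q : Fin n → ℝ} (hq : q ∈ credalSet m.bel)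
    {p : Fin n → ℝ} {l : List (Finset (Fin n) × Finset (Fin n))} {S : Finset (Fin n)}
    (h : IsPrincipalChain m S l Finset.univ) (hp : IsBlockVector m p l) {β : ℝ} (hβ : 0 ≤ β)
    (hS : IsPenalizedMinimizer m β S) (h0 : β = 0 → m.pl S = 0) :
    (m.pl S - ∑ i ∈ S, q i) * Real.log β ≤
      ∑ i ∈ Finset.univ \ S, (q i * Real.log (q i) - p i * Real.log (p i) - q i + p i) := by
  induction l generalizing S β with
  | nil =>
    obtain rfl : S = Finset.univ := h
    simp [pl_univ, hq.1.2]
  | cons e l ih =>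
    obtain ⟨rfl, h1, h2, h3⟩ := h
    have hle : β ≤ slope m e.1 e.2 := hS.le_slope h1
    have hpe := hp e (by simp)
    have hcard := slope_mul_card_sdiff (m := m) h1
    set a := slope m e.1 e.2 with ha
    have ha0 : a = 0 → m.pl e.2 = 0 := by
      intro haz
      have := h0 (le_antisymm (haz ▸ hle) hβ)
      rw [haz, zero_mul] at hcard
      linarith
    have hrest := ih h3 (fun e he => hp e (List.mem_cons_of_mem _ he)) (hβ.trans hle)
      ((isPenalizedMinimizer_slope_iff h1).1 h2) ha0
    have hDS := sum_le_pl_of_mem_credalSet hq e.1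
    have hfirst : (m.pl e.1 - ∑ i ∈ e.1, q i) * Real.log β ≤
        (m.pl e.1 - ∑ i ∈ e.1, q i) * Real.log a := by
      rcases hβ.eq_or_lt with hβ0 | hβ0
      · have hq0 : 0 ≤ ∑ i ∈ e.1, q i := Finset.sum_nonneg fun i _ => hq.1.1 i
        have hpl := h0 hβ0.symm
        have : m.pl e.1 - ∑ i ∈ e.1, q i = 0 := by linarith
        simp [this]
      · exact mul_le_mul_of_nonneg_left (Real.log_le_log hβ0 hle) (sub_nonneg.2 hDS)
    have hblock : ((m.pl e.1 - ∑ i ∈ e.1, q i) - (m.pl e.2 - ∑ i ∈ e.2, q i)) * Real.log a ≤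
        ∑ i ∈ e.2 \ e.1, (q i * Real.log (q i) - p i * Real.log (p i) - q i + p i) := by
      rcases (hβ.trans hle).eq_or_lt with haz | hapos
      · -- `q` and `p` vanish on a block of slope zero
        have hz : ∀ i ∈ e.2 \ e.1, q i = 0 := by
          intro i hi
          refine le_antisymm ?_ (hq.1.1 i)
          have h4 := Finset.single_le_sum (f := q) (fun j _ => hq.1.1 j) (Finset.mem_sdiff.1 hi).1
          have h5 := sum_le_pl_of_mem_credalSet hq e.2
          rw [ha0 haz.symm] at h5
          exact h4.trans h5
        rw [← haz, Real.log_zero, mul_zero]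
        exact (Finset.sum_eq_zero fun i hi => by simp [hz i hi, hpe i hi, ← haz]).ge
      · have hsd := Finset.sum_sdiff (f := q) h1.1
        calc _ = ∑ i ∈ e.2 \ e.1, (q i - a) * Real.log a := by
              rw [← Finset.sum_mul, Finset.sum_sub_distrib, Finset.sum_const, nsmul_eq_mul]
              congr 1
              linarith
          _ ≤ _ := Finset.sum_le_sum fun i hi => by
              rw [hpe i hi]
              exact mul_log_tangent (hq.1.1 i) hapos
    rw [sum_sdiff_add_sum_sdiff h1.1 (Finset.subset_univ e.2)]
    linarith

theorem IsPrincipalChain.isUpperEntropy {l : List (Finset (Fin n) × Finset (Fin n))}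
    (h : IsPrincipalChain m ∅ l Finset.univ) {p : Fin n → ℝ} (hp : IsBlockVector m p l) :
    IsUpperEntropy m.bel (entropy p) := by
  have hmem := h.mem_credalSet hp
  refine ⟨⟨p, hmem, rfl⟩, ?_⟩
  rintro _ ⟨q, hq, rfl⟩
  have := h.entropy_bound hq hp le_rfl isPenalizedMinimizer_empty (by simp)
  simp only [Finset.sum_add_distrib, Finset.sum_sub_distrib, Finset.sdiff_empty, hq.1.2,
    hmem.1.2, pl_empty, Finset.sum_empty, sub_zero, zero_mul] at this
  simp only [entropy]
  linarith

end Plausibility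

/-! ### The decomposition algorithm and its cost -/

section Programs

variable {n : ℕ} {m : MassFunction n}

theorem val_plProg (m : MassFunction n) (B : Finset (Fin n)) : (plProg m B).val = m.pl B := by
  have hhit : ∀ F : Finset (Fin n),
      (List.finRange n).foldl (fun b j => b || decide (j ∈ F ∧ j ∈ B)) false =
        decide (F ∩ B ≠ ∅) := by
    intro F
    have := foldl_invariant (g := fun (b : Bool) (j : Fin n) => b || decide (j ∈ F ∧ j ∈ B))
      (fun done b => b = true ↔ ∃ j ∈ done, j ∈ F ∧ j ∈ B) (by
        intro done b i hb
        simp only [Bool.or_eq_true, hb, decide_eq_true_eq, List.mem_append, List.mem_singleton]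
        grind) (List.finRange n) [] false (by simp)
    rw [Bool.eq_iff_iff, this, decide_eq_true_eq, ← Finset.nonempty_iff_ne_empty]
    simp [Finset.Nonempty]
  have hsum : ∀ (l : List (Finset (Fin n))) (x : ℝ),
      l.foldl (fun x F => if F ∩ B ≠ ∅ then x + m.mass F else x) x =
        x + (l.map fun F => if F ∩ B ≠ ∅ then m.mass F else 0).sum := by
    intro l
    induction l with
    | nil => simp
    | cons F l ih =>
      intro x
      simp only [List.foldl_cons, List.map_cons, List.sum_cons, ih]
      split_ifs <;> ring
  simp only [plProg, val_loop, val_bind, val_pure, hhit, decide_eq_true_eq, hsum, zero_add,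
    Finset.sum_map_toList]
  rw [pl_eq_sum_focal, Finset.univ_eq_attach,
    Finset.sum_attach m.focal (fun F => if F ∩ B ≠ ∅ then m.mass F else 0)]

theorem steps_plProg_le (m : MassFunction n) (B : Finset (Fin n)) :
    (plProg m B).steps ≤ m.focal.card * (n + 1) := by
  refine (steps_loop_le (c := n) _ _ fun x F => ?_).trans (by simp)
  simp only [steps_bind, steps_pure, add_zero]
  exact (steps_loop_le (c := 0) _ _ fun b j => by simp).trans (by simp)

theorem val_slopeProg (m : MassFunction n) (S S' : Finset (Fin n)) :
    (slopeProg m S S').val = slope m S S' := by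
  have hcard : ∀ (l : List (Fin n)) (x : ℝ),
      l.foldl (fun c i => if i ∈ S' ∧ i ∉ S then c + 1 else c) x =
        x + (l.map fun i => if i ∈ S' \ S then (1 : ℝ) else 0).sum := by
    intro l
    induction l with
    | nil => simp
    | cons i l ih =>
      intro x
      simp only [List.foldl_cons, List.map_cons, List.sum_cons, ih, Finset.mem_sdiff]
      split_ifs <;> ring
  simp only [slopeProg, val_bind, val_loop, val_pure, val_plProg, hcard, slope]
  congr 1
  rw [zero_add, ← Fin.sum_univ_def, Finset.sum_boole, Finset.filter_univ_mem]

theorem steps_slopeProg_le (m : MassFunction n) (S S' : Finset (Fin n)) :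
    (slopeProg m S S').steps ≤ 2 * (m.focal.card * (n + 1)) + n + 1 := by
  have h1 := steps_plProg_le m S'
  have h2 := steps_plProg_le m S
  have h3 := steps_loop_le (c := 0) (List.finRange n) (0 : ℝ)
    (body := fun c i => (pure (if i ∈ S' ∧ i ∉ S then c + 1 else c) : Counted ℝ)) (by simp)
  simp only [List.length_finRange] at h3
  simp only [slopeProg, steps_bind, steps_charge, steps_pure]
  omega

theorem flows_slopeProg (m : MassFunction n) (S S' : Finset (Fin n)) :
    (slopeProg m S S').flows = 0 := by
  have h : ∀ B, (plProg m B).flows = 0 := fun B => flows_loop _ _ fun x F => by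
    simp [flows_loop]
  simp [slopeProg, h, flows_loop]

theorem searches_slopeProg (m : MassFunction n) (S S' : Finset (Fin n)) :
    (slopeProg m S S').searches = 0 := by
  have h : ∀ B, (plProg m B).searches = 0 := fun B => searches_loop _ _ fun x F => by
    simp [searches_loop]
  simp [slopeProg, h, searches_loop]

theorem val_sameProg (S S' : Finset (Fin n)) : (sameProg S S').val = decide (S = S') := by
  have := foldl_invariant (g := fun (b : Bool) (i : Fin n) => b && decide (i ∈ S ↔ i ∈ S'))
    (fun done b => b = true ↔ ∀ i ∈ done, (i ∈ S ↔ i ∈ S')) (by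
      intro done b i hb
      simp only [Bool.and_eq_true, hb, decide_eq_true_eq, List.mem_append, List.mem_singleton]
      grind) (List.finRange n) [] true (by simp)
  rw [Bool.eq_iff_iff, decide_eq_true_eq, Finset.ext_iff]
  simpa [sameProg, val_loop] using this

theorem steps_sameProg_le (S S' : Finset (Fin n)) : (sameProg S S').steps ≤ n :=
  (steps_loop_le (c := 0) _ _ fun b j => by simp).trans (by simp)

theorem flows_sameProg (S S' : Finset (Fin n)) : (sameProg S S').flows = 0 :=
  flows_loop _ _ fun _ _ => rfl

theorem searches_sameProg (S S' : Finset (Fin n)) : (sameProg S S').searches = 0 :=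
  searches_loop _ _ fun _ _ => rfl

/-- A bound for the cost of one call of the decomposition algorithm, its recursive calls excepted,
when a maximum flow costs at most `T`. -/
def callCost (n k T : ℕ) : ℕ :=
  2 * (k * (n + 1)) + n + 1 + (T + (n + k + 2) * (n + k + 3) + n) + n + (n + 1)

/-- A call for two sets whose cardinalities differ by `d` leads to at most `2 d - 1` calls, itself
included: the set found by the minimization step splits `d` into two positive parts. -/
theorem decompose_spec {mf : FlowSolver m} {T : ℕ}
    (hmf : ∀ α, 0 ≤ α → (network m α).IsMaxFlow (mf α).1 ∧ (mf α).2 ≤ T) (k : ℕ)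
    {S S' : Finset (Fin n)} (h : S ⊂ S') {β β' : ℝ} (hS : IsPenalizedMinimizer m β S)
    (hS' : IsMaximalMinimizer (fun A => m.pl A - β' * (A.card : ℝ)) S')
    (hk : S'.card ≤ S.card + k) :
    ∃ l, (decompose mf k S S').val = some l ∧ IsPrincipalChain m S l S' ∧
      (decompose mf k S S').flows + 1 + 2 * S.card ≤ 2 * S'.card ∧
      (decompose mf k S S').searches + 1 + 2 * S.card ≤ 2 * S'.card ∧
      (decompose mf k S S').steps + callCost n m.focal.card T +
        2 * S.card * callCost n m.focal.card T ≤ 2 * S'.card * callCost n m.focal.card T := by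
  induction k generalizing S S' β β' with
  | zero =>
    have := Finset.card_lt_card h
    omega
  | succ k ih =>
    have hα := slope_nonneg (m := m) h
    obtain ⟨hmax, hT⟩ := hmf _ hα
    have hA := (isMaximalMinimizer_nonReaching hα hmax).1
    have c1 := steps_slopeProg_le m S S'
    have c2 := steps_minimizerProg_le mf (slope m S S')
    have c3 := steps_sameProg_le (nonReaching m (slope m S S') (mf (slope m S S')).1) S'
    have hcard := Finset.card_lt_card h
    simp only [decompose, val_bind, flows_bind, searches_bind, steps_bind, val_slopeProg,
      val_minimizerProg, val_sameProg, flows_slopeProg, flows_minimizerProg, flows_sameProg,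
      searches_slopeProg, searches_minimizerProg, searches_sameProg]
    set A := nonReaching m (slope m S S') (mf (slope m S S')).1 with hAdef
    set K := callCost n m.focal.card T with hK
    by_cases hAS : A = S'
    · rw [hAS] at c3 ⊢
      simp only [decide_true, if_true, val_pure, flows_pure, searches_pure, steps_pure]
      refine ⟨_, rfl, ⟨rfl, h, (isPenalizedMinimizer_slope_iff h).2 (hAS ▸ hA.1), rfl⟩,
        by omega, by omega, ?_⟩
      have h2 : (2 * S.card + 2) * K ≤ 2 * S'.card * K := Nat.mul_le_mul_right _ (by omega)
      have h1 : (slopeProg m S S').steps + ((minimizerProg mf (slope m S S')).steps +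
          ((sameProg S' S').steps + 0)) ≤ K := by
        rw [hK, callCost]
        omega
      linarith
    · obtain ⟨hSA, hAS'⟩ := minimizer_between h hS hS' hA hAS
      have hc1 := Finset.card_lt_card hSA
      have hc2 := Finset.card_lt_card hAS'
      obtain ⟨l₁, v1, p1, f1, s1, t1⟩ := ih hSA hS hA (by omega)
      obtain ⟨l₂, v2, p2, f2, s2, t2⟩ := ih hAS' hA.1 hS' (by omega)
      simp only [hAS, decide_false, Bool.false_eq_true, if_false, val_bind, flows_bind,
        searches_bind, steps_bind, v1, v2, val_pure, flows_pure, searches_pure, steps_pure,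
        flows_charge, searches_charge, steps_charge]
      refine ⟨_, rfl, p1.append p2, by omega, by omega, ?_⟩
      have hlen := p1.length_add_card_le
      have hn : A.card ≤ n := by simpa using A.card_le_univ
      have h1 : (slopeProg m S S').steps + ((minimizerProg mf (slope m S S')).steps +
          ((sameProg A S').steps + (l₁.length + 1))) ≤ K := by
        rw [hK, callCost]
        omega
      linarith

theorem foldl_update_block (p : Fin n → ℝ) (q : ℝ) (S S' : Finset (Fin n)) (i : Fin n) :
    (List.finRange n).foldl
      (fun p i => if i ∈ S' ∧ i ∉ S then Function.update p i q else p) p i =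
      if i ∈ S' \ S then q else p i := by
  have := foldl_invariant (g := fun (p : Fin n → ℝ) i =>
      if i ∈ S' ∧ i ∉ S then Function.update p i q else p)
    (fun done p' => ∀ i, p' i = if i ∈ done ∧ i ∈ S' \ S then q else p i) (by
      intro done p' j hp' i
      simp only [Finset.mem_sdiff, List.mem_append, List.mem_singleton] at hp' ⊢
      by_cases hij : i = j
      · subst hij
        split_ifs <;> simp_all
      · split_ifs <;> simp_all [Function.update_of_ne]) (List.finRange n) [] p (by simp)
  simpa using this i

theorem isBlockVector_optimalProg {S S' : Finset (Fin n)}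
    {l : List (Finset (Fin n) × Finset (Fin n))} (h : IsPrincipalChain m S l S') :
    IsBlockVector m (optimalProg m l).val l := by
  simp only [optimalProg, val_loop, val_bind, val_slopeProg, val_pure]
  generalize (fun _ => 0 : Fin n → ℝ) = p
  -- the later rounds do not change the entries of `p` at the elements of `S`
  have key : ∀ (l : List (Finset (Fin n) × Finset (Fin n))) (S : Finset (Fin n)) (p : Fin n → ℝ),
      IsPrincipalChain m S l S' → ∀ r : Fin n → ℝ,
      r = l.foldl (fun p e => (List.finRange n).foldl (fun p i =>
        if i ∈ e.2 ∧ i ∉ e.1 then Function.update p i (slope m e.1 e.2) else p) p) p →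
      IsBlockVector m r l ∧ ∀ i ∈ S, r i = p i := by
    intro l
    induction l with
    | nil =>
      rintro S p - r rfl
      exact ⟨by simp [IsBlockVector], fun i _ => rfl⟩
    | cons e l ih =>
      rintro S p ⟨rfl, h1, -, h3⟩ r hr
      obtain ⟨i1, i2⟩ := ih e.2 _ h3 r hr
      simp only [foldl_update_block] at i2
      refine ⟨fun e' he' i hi => ?_, fun i hi => ?_⟩
      · rcases List.mem_cons.1 he' with rfl | he'
        · rw [i2 i (Finset.mem_sdiff.1 hi).1, if_pos hi]
        · exact i1 e' he' i hi
      · rw [i2 i (h1.1 hi), if_neg fun h => (Finset.mem_sdiff.1 h).2 hi]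
  exact (key l S p h _ rfl).1

theorem steps_optimalProg_le (m : MassFunction n) (l : List (Finset (Fin n) × Finset (Fin n))) :
    (optimalProg m l).steps ≤ l.length * (2 * (m.focal.card * (n + 1)) + n + 1 + n + 1) := by
  refine steps_loop_le _ _ fun p e => ?_
  have h1 := steps_slopeProg_le m e.1 e.2
  have h2 := steps_loop_le (c := 0) (List.finRange n) p
    (body := fun p i => (pure (if i ∈ e.2 ∧ i ∉ e.1 then
      Function.update p i (slopeProg m e.1 e.2).val else p) : Counted (Fin n → ℝ)))
    (by intros; simp)
  simp only [List.length_finRange] at h2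
  simp only [steps_bind]
  omega

theorem flows_optimalProg (m : MassFunction n) (l : List (Finset (Fin n) × Finset (Fin n))) :
    (optimalProg m l).flows = 0 :=
  flows_loop _ _ fun p e => by
    simp only [flows_bind, flows_slopeProg, zero_add]
    exact flows_loop _ _ fun p i => rfl

theorem searches_optimalProg (m : MassFunction n) (l : List (Finset (Fin n) × Finset (Fin n))) :
    (optimalProg m l).searches = 0 :=
  searches_loop _ _ fun p e => by
    simp only [searches_bind, searches_slopeProg, zero_add]
    exact searches_loop _ _ fun p i => rfl

theorem val_entropyProg (p : Fin n → ℝ) : (entropyProg p).val = entropy p := by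
  have hsum : ∀ (l : List (Fin n)) (x : ℝ), l.foldl (fun h i => h - p i * Real.log (p i)) x =
      x - (l.map fun i => p i * Real.log (p i)).sum := by
    intro l
    induction l with
    | nil => simp
    | cons i l ih =>
      intro x
      simp only [List.foldl_cons, List.map_cons, List.sum_cons, ih]
      ring
  simp only [entropyProg, val_loop, val_pure, hsum, entropy, zero_sub, Fin.sum_univ_def]

theorem steps_entropyProg_le (p : Fin n → ℝ) : (entropyProg p).steps ≤ n :=
  (steps_loop_le (c := 0) _ _ fun b j => by simp).trans (by simp)

theorem pos_of_massFunction (m : MassFunction n) : 0 < n := by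
  rcases Nat.eq_zero_or_pos n with rfl | h
  · have h1 := pl_univ m
    rw [Finset.univ_eq_empty, pl_empty] at h1
    norm_num at h1
  · exact h

theorem focal_card_pos (m : MassFunction n) : 0 < m.focal.card := by
  rw [Finset.card_pos]
  by_contra h
  rw [Finset.not_nonempty_iff_eq_empty] at h
  have h1 := m.mass_sum
  rw [Finset.sum_eq_zero fun A _ => ?_] at h1
  · norm_num at h1
  · refine le_antisymm (not_lt.1 fun hA => ?_) (m.mass_nonneg A)
    have : A ∈ m.focal := by simp [MassFunction.focal, hA]
    simp [h] at this

theorem upperEntropyProg_spec {mf : FlowSolver m} {T : ℕ}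
    (hmf : ∀ α, 0 ≤ α → (network m α).IsMaxFlow (mf α).1 ∧ (mf α).2 ≤ T) :
    IsCorrectResult m (upperEntropyProg mf).val ∧
      (upperEntropyProg mf).flows ≤ 2 * n ∧ (upperEntropyProg mf).searches ≤ 2 * n ∧
      (upperEntropyProg mf).steps ≤ 30 * n * (T + (n + m.focal.card) ^ 2) := by
  have hn := pos_of_massFunction m
  have hF := focal_card_pos m
  have hne : (∅ : Finset (Fin n)) ⊂ Finset.univ :=
    Finset.ssubset_univ_iff.2 fun h => by
      have := congrArg Finset.card h
      simp at this
      omega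
  obtain ⟨l, hl, hc, hf, hs, ht⟩ := decompose_spec hmf n hne isPenalizedMinimizer_empty
    isMaximalMinimizer_univ (by simp)
  have hlen := hc.length_add_card_le
  simp only [Finset.card_empty, Finset.card_univ, Fintype.card_fin, mul_zero, add_zero,
    zero_mul] at hf hs ht hlen
  have hflow : ∀ p : Fin n → ℝ, (entropyProg p).flows = 0 := fun p => flows_loop _ _ fun _ _ => rfl
  have hsearch : ∀ p : Fin n → ℝ, (entropyProg p).searches = 0 :=
    fun p => searches_loop _ _ fun _ _ => rfl
  simp only [upperEntropyProg, val_bind, flows_bind, searches_bind, steps_bind, hl, val_pure,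
    flows_pure, searches_pure, steps_pure, flows_optimalProg, searches_optimalProg, hflow, hsearch]
  have hp := isBlockVector_optimalProg hc
  refine ⟨⟨_, _, rfl, hc.mem_credalSet hp, (val_entropyProg _).symm, ?_⟩, by omega, by omega, ?_⟩
  · rw [val_entropyProg]
    exact hc.isUpperEntropy hp
  · have h1 := steps_optimalProg_le m l
    have h2 := steps_entropyProg_le (optimalProg m l).val
    have h3 := Nat.mul_le_mul_right (2 * (m.focal.card * (n + 1)) + n + 1 + n + 1) hlen
    set k := m.focal.card
    have e1 : k * (n + 1) ≤ (n + k) ^ 2 := by nlinarith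
    have e2 : n + k ≤ (n + k) ^ 2 := Nat.le_self_pow (by norm_num) _
    have e3 : 2 * (n + k) ≤ (n + k) ^ 2 := by nlinarith
    have e4 : (n + k + 2) * (n + k + 3) ≤ 5 * (n + k) ^ 2 := by nlinarith
    have e5 : callCost n k T ≤ T + 12 * (n + k) ^ 2 := by
      rw [callCost]
      omega
    have e6 : 2 * (k * (n + 1)) + n + 1 + n + 1 ≤ 5 * (n + k) ^ 2 := by omega
    have e7 := Nat.mul_le_mul_left (2 * n) e5
    have e8 := Nat.mul_le_mul_left n e6
    have e9 : n * 1 ≤ n * (n + k) ^ 2 := Nat.mul_le_mul_left n (Nat.one_le_pow _ _ (by omega))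
    nlinarith [Nat.zero_le (n * T)]

end Programs
end UpperEntropy

open UpperEntropy in
theorem proposition4 :
    -- every minimization step is a maximum-flow computation
    (∀ (n : ℕ) (m : MassFunction n) (α : ℝ), 0 ≤ α →
      (∃ f, (network m α).IsMaxFlow f) ∧
      ∀ f, (network m α).IsMaxFlow f →
        IsMaximalMinimizer (fun A => m.pl A - α * (A.card : ℝ)) (nonReaching m α f) ∧
        (network m α).value f =
          m.pl (nonReaching m α f) - α * ((nonReaching m α f).card : ℝ) + n * α) ∧
    -- numbers of flows, searches and steps, for every maximum-flow procedure
    (∃ C : ℕ, ∀ (n : ℕ) (m : MassFunction n) (mf : FlowSolver m) (T : ℕ),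
      (∀ α, 0 ≤ α → (network m α).IsMaxFlow (mf α).1 ∧ (mf α).2 ≤ T) →
        (∀ α, 0 ≤ α → (minimizerProg mf α).val = nonReaching m α (mf α).1 ∧
          (minimizerProg mf α).flows = 1 ∧ (minimizerProg mf α).searches = 1) ∧
        IsCorrectResult m (upperEntropyProg mf).val ∧
        (upperEntropyProg mf).flows ≤ C * n ∧
        (upperEntropyProg mf).searches ≤ C * n ∧
        (upperEntropyProg mf).steps ≤ C * n * (T + (n + m.focal.card) ^ 2)) ∧
    -- with a suitable procedure, the whole running time is polynomial
    (∃ C d : ℕ, ∀ (n : ℕ) (m : MassFunction n),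
      (∀ α, 0 ≤ α → (network m α).IsMaxFlow (edmondsKarpSolver m α).1) ∧
      IsCorrectResult m (upperEntropyProg (edmondsKarpSolver m)).val ∧
      (upperEntropyProg (edmondsKarpSolver m)).steps ≤ C * (n + m.focal.card) ^ d) := by
  refine ⟨fun n m α hα => ⟨⟨_, isMaxFlow_edmondsKarpSolver m hα⟩,
    fun f hf => isMaximalMinimizer_nonReaching hα hf⟩, ⟨30, fun n m mf T hmf => ?_⟩,
    ⟨30 * 705, 7, fun n m => ?_⟩⟩
  · obtain ⟨h1, h2, h3, h4⟩ := upperEntropyProg_spec hmf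
    exact ⟨fun α _ =>
      ⟨val_minimizerProg mf α, flows_minimizerProg mf α, searches_minimizerProg mf α⟩, h1, by omega, by omega, h4⟩
  · have hn := pos_of_massFunction m
    have hF := focal_card_pos m
    obtain ⟨h1, -, -, h4⟩ := upperEntropyProg_spec (mf := edmondsKarpSolver m)
      (T := 11 * (n + m.focal.card + 2) ^ 6) fun α hα =>
        ⟨isMaxFlow_edmondsKarpSolver m hα,
          (steps_edmondsKarp_le (network m α)).trans_eq (by rw [card_node])⟩
    refine ⟨fun α hα => isMaxFlow_edmondsKarpSolver m hα, h1, h4.trans ?_⟩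
    set k := m.focal.card
    -- `n + k + 2 ≤ 2 * (n + k)`, and `11 * 2 ^ 6 = 704`
    have e1 : (n + k + 2) ^ 6 ≤ (2 * (n + k)) ^ 6 := Nat.pow_le_pow_left (by omega) 6
    have e2 : (n + k) ^ 2 ≤ (n + k) ^ 6 := Nat.pow_le_pow_right (by omega) (by norm_num)
    have e3 : 11 * (n + k + 2) ^ 6 + (n + k) ^ 2 ≤ 705 * (n + k) ^ 6 := by
      rw [mul_pow] at e1
      omega
    calc 30 * n * (11 * (n + k + 2) ^ 6 + (n + k) ^ 2)
        ≤ 30 * (n + k) * (705 * (n + k) ^ 6) := Nat.mul_le_mul (by omega) e3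
      _ = 30 * 705 * (n + k) ^ 7 := by ring
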